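/- Let $\mathbb T=\mathbb R/\mathbb Z$. The Bohr topology on $\mathbb Z$ is the weakest topology making every homomorphism $\mathbb Z\to\mathbb T$ continuous, and a set $S\subseteq\mathbb Z$ is Bohr dense if it is dense in this topology. A set $R\subseteq\mathbb Z$ is a set of measurable recurrence if for every probability space $(X,\mu)$, every invertible measure preserving transformation $T:X\to X$ and every measurable $D\subseteq X$ with $\mu(D)>0$ there is an $n\in R$ with $D\cap T^nD\neq\varnothing$. For $A\subseteq\mathbb Z$ let $d^*(A)=\limsup_{n\to\infty}\sup_{k\in\mathbb Z}|A\cap\{k+1,\dots,k+n\}|/n$ be its upper Banach density. The difference set topology on $\mathbb Z$ is the topology in which $U\subseteq\mathbb Z$ is open if and only if, for every $x\in U$, $U$ contains the intersection of finitely many sets of the form $x+(A-A)$ with $A\subseteq\mathbb Z$ and $d^*(A)>0$. Corollary. Every Bohr dense set $S\subseteq\mathbb Z$ contains a Bohr dense subset $S'\subseteq S$ such that, for every $m\in\mathbb Z$, the set $(S'-m)\setminus\{0\}$ is not a set of measurable recurrence. Moreover, $S'$ can be chosen so that, in addition, it is closed and nowhere dense in the difference set topology. -/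

import Mathlib

open scoped Pointwise

/-- The Bohr topology of `ℤ`: the weakest topology making every homomorphism from `ℤ` into
`𝕋 = ℝ/ℤ` continuous. It is not an instance: `ℤ` already carries the discrete topology. -/
@[reducible] noncomputable def bohrTopology : TopologicalSpace ℤ :=
  ⨅ χ : ℤ →+ UnitAddCircle, TopologicalSpace.induced χ inferInstance

/-- `S ⊆ ℤ` is Bohr dense if it is dense in the Bohr topology. -/
def IsBohrDense (S : Set ℤ) : Prop :=
  @Dense ℤ bohrTopology S

/-- `S ⊆ ℤ` is a set of measurable recurrence if for every probability measure preserving system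
`(X, μ, T)` with `T` invertible, and every measurable `D ⊆ X` with `μ(D) > 0`, there is an `n ∈ S`
with `D ∩ Tⁿ D ≠ ∅`. -/
def IsMeasurableRecurrence (S : Set ℤ) : Prop :=
  ∀ (X : Type) [MeasurableSpace X] (μ : MeasureTheory.Measure X)
    [MeasureTheory.IsProbabilityMeasure μ] (T : X ≃ᵐ X),
    MeasureTheory.MeasurePreserving T μ μ →
      ∀ D : Set X, MeasurableSet D → 0 < μ D →
        ∃ n ∈ S, (D ∩ ((T.toEquiv : Equiv.Perm X) ^ n) '' D).Nonempty

/-- The upper Banach density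
`d*(A) = limsup_{n → ∞} sup_{k ∈ ℤ} |A ∩ {k + 1, …, k + n}| / n`. -/
noncomputable def upperBanachDensity (A : Set ℤ) : ℝ :=
  Filter.limsup
    (fun n : ℕ => ⨆ k : ℤ, ((A ∩ Set.Icc (k + 1) (k + (n : ℤ))).ncard : ℝ) / (n : ℝ))
    Filter.atTop

/-- The difference set topology on `ℤ`: the neighbourhoods of `0` are generated by the difference
sets `A - A` of sets `A` of positive upper Banach density, and those of a general point `x` are
their translates by `x`. So `U` is open if and only if, for every `x ∈ U`, the set `U` contains a
finite intersection of sets of the form `x + (A - A)` with `d*(A) > 0`. -/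
@[reducible] noncomputable def differenceSetTopology : TopologicalSpace ℤ :=
  TopologicalSpace.mkOfNhds fun x : ℤ =>
    Filter.generate {V : Set ℤ | ∃ A : Set ℤ, 0 < upperBanachDensity A ∧ V = x +ᵥ (A - A)}

/-! The set `S'` is a union of finite sets. For every `m` reached so far the construction keeps a
certificate: a set `A ⊆ ℤ/N` of density greater than a constant `c m > 0`, disjoint from its
translates by `1` and by the nonzero elements of `S' - m` already chosen (`HasAvoidingSet`). The
constant never changes once chosen, so a limit of shift-invariant measures turns the certificates
for `m` into one system showing that `(S' - m) \ {0}` is not a set of recurrence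
(`not_isMeasurableRecurrence_of_hasAvoidingSet`).

Certificates survive the addition of new elements by a majority vote
(`HasAvoidingSet.exists_extension`). Rotation of a `d`-dimensional torus by a point whose
coordinates are close to `1/N` imitates `d` copies of `ℤ/N` and codes an integer by a word of length
`d` over `ℤ/N`. The new avoiding set consists of integers whose word has its most frequent letter,
by a margin, in `A`. A translation acting as some `g` in all but `k` coordinates moves that letter
by `g`, so it is still avoided. By anticoncentration, words without a clear leader are rare for
large `d`, so the strict density bound persists.

The `k` spoiled coordinates pay for Bohr density. If the rotation has independent coordinates, a
Bohr condition of rank `r` interferes with at most `r` of them (`exists_card_le_forall_eq_zero`).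
Kronecker's theorem (`exists_zsmul_near`) and the density of `S` then give `s ∈ S` meeting the
condition while `s - m` acts like `1` elsewhere. Compactness of the torus makes finitely many `s`
suffice for all conditions of rank `r`.

The topological claims use only non-recurrence: some `A - A` with `d*(A) > 0` misses `(S' - x) \
{0}`, while finite intersections of difference sets always contain nonzero points. -/

/-! ### Characters of the circle and Kronecker's theorem -/

/-- The standard character `x ↦ exp (2πix)` of the circle `ℝ/ℤ`. -/
noncomputable def circleExp (x : UnitAddCircle) : ℂ := (AddCircle.toCircle x : ℂ)

theorem circleExp_zero : circleExp 0 = 1 := by simp [circleExp]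

theorem circleExp_add (x y : UnitAddCircle) :
    circleExp (x + y) = circleExp x * circleExp y := by
  simp [circleExp, AddCircle.toCircle_add]

theorem circleExp_nsmul (n : ℕ) (x : UnitAddCircle) : circleExp (n • x) = circleExp x ^ n := by
  simp [circleExp, AddCircle.toCircle_nsmul]

theorem norm_circleExp (x : UnitAddCircle) : ‖circleExp x‖ = 1 :=
  Circle.norm_coe _

theorem conj_circleExp (x : UnitAddCircle) :
    (starRingEnd ℂ) (circleExp x) = circleExp (-x) := by
  rw [circleExp, circleExp, AddCircle.toCircle_neg, Circle.coe_inv_eq_conj]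

theorem circleExp_sum {ι : Type*} (s : Finset ι) (f : ι → UnitAddCircle) :
    circleExp (∑ i ∈ s, f i) = ∏ i ∈ s, circleExp (f i) := by
  classical
  induction s using Finset.induction_on with
  | empty => simp [circleExp_zero]
  | insert a s ha ih => rw [Finset.sum_insert ha, Finset.prod_insert ha, circleExp_add, ih]

theorem circleExp_eq_one_iff {x : UnitAddCircle} : circleExp x = 1 ↔ x = 0 := by
  constructor
  · intro h
    apply AddCircle.injective_toCircle one_ne_zero
    apply Subtype.ext
    rw [AddCircle.toCircle_zero]
    exact h
  · rintro rfl
    exact circleExp_zero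

theorem continuous_circleExp : Continuous circleExp :=
  continuous_subtype_val.comp AddCircle.continuous_toCircle

theorem tendsto_average_circleExp (x : UnitAddCircle) :
    Filter.Tendsto (fun M : ℕ => (∑ n ∈ Finset.range M, circleExp (n • x)) / (M : ℂ))
      Filter.atTop (nhds (if x = 0 then 1 else 0)) := by
  split_ifs with h
  · subst h
    apply tendsto_const_nhds.congr'
    filter_upwards [Filter.eventually_gt_atTop 0] with M hM
    have : (M : ℂ) ≠ 0 := by exact_mod_cast hM.ne'
    simp [circleExp_zero, this]
  · have hz : circleExp x ≠ 1 := fun h' => h (circleExp_eq_one_iff.1 h')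
    rw [tendsto_zero_iff_norm_tendsto_zero]
    refine squeeze_zero (g := fun M : ℕ => (2 / ‖circleExp x - 1‖) / (M : ℝ))
      (fun _ => norm_nonneg _) (fun M => ?_) (tendsto_const_div_atTop_nhds_zero_nat _)
    simp only [circleExp_nsmul]
    rw [geom_sum_eq hz, norm_div, norm_div, Complex.norm_natCast]
    gcongr
    calc ‖circleExp x ^ M - 1‖ ≤ ‖circleExp x ^ M‖ + ‖(1 : ℂ)‖ := norm_sub_le _ _
      _ = 2 := by rw [norm_pow, norm_circleExp]; norm_num

/-- The mean square of an almost periodic polynomial with nonnegative coefficients, whose phases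
depend only on the frequencies, is at least the sum of the squares of the coefficients. -/
theorem sum_sq_le_of_norm_sq_le {B : Type*} (s : Finset B) (c : B → ℝ) (hc : ∀ b, 0 ≤ c b)
    (θ η : B → UnitAddCircle) (hcomp : ∀ b b', θ b = θ b' → η b = η b') (K : ℝ)
    (hK : ∀ n : ℕ, ‖∑ b ∈ s, (c b : ℂ) * circleExp (n • θ b - η b)‖ ^ 2 ≤ K) :
    ∑ b ∈ s, c b ^ 2 ≤ K := by
  classical
  have hexp : ∀ n : ℕ, ((‖∑ b ∈ s, (c b : ℂ) * circleExp (n • θ b - η b)‖ ^ 2 : ℝ) : ℂ)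
      = ∑ b ∈ s, ∑ b' ∈ s, ((c b * c b' : ℝ) : ℂ) * circleExp (-(η b - η b')) *
          circleExp (n • (θ b - θ b')) := by
    intro n
    rw [Complex.ofReal_pow, ← Complex.mul_conj', map_sum, Finset.sum_mul_sum]
    refine Finset.sum_congr rfl fun b _ => Finset.sum_congr rfl fun b' _ => ?_
    rw [map_mul, Complex.conj_ofReal, conj_circleExp, Complex.ofReal_mul,
      show (c b : ℂ) * circleExp (n • θ b - η b) * ((c b' : ℂ) * circleExp (-(n • θ b' - η b')))
        = (c b : ℂ) * c b' * (circleExp (n • θ b - η b) * circleExp (-(n • θ b' - η b'))) by ring,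
      mul_assoc ((c b : ℂ) * c b'), ← circleExp_add, ← circleExp_add]
    congr 2
    rw [smul_sub]
    abel
  -- Averaging over `n` kills every pair of distinct frequencies. For equal frequencies `hcomp`
  -- makes the phases cancel, so the surviving cross terms are nonnegative and may be dropped.
  have hlim : Filter.Tendsto (fun M : ℕ => ∑ b ∈ s, ∑ b' ∈ s,
      ((c b * c b' : ℝ) : ℂ) * circleExp (-(η b - η b')) *
        ((∑ n ∈ Finset.range M, circleExp (n • (θ b - θ b'))) / (M : ℂ)))
      Filter.atTop (nhds (∑ b ∈ s, ∑ b' ∈ s, ((c b * c b' : ℝ) : ℂ) *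
        circleExp (-(η b - η b')) * (if θ b - θ b' = 0 then 1 else 0))) :=
    tendsto_finsetSum _ fun b _ => tendsto_finsetSum _ fun b' _ =>
      (tendsto_average_circleExp _).const_mul _
  have hval : (∑ b ∈ s, ∑ b' ∈ s, ((c b * c b' : ℝ) : ℂ) *
        circleExp (-(η b - η b')) * (if θ b - θ b' = 0 then 1 else 0))
      = ((∑ b ∈ s, ∑ b' ∈ s, if θ b = θ b' then c b * c b' else 0 : ℝ) : ℂ) := by
    push_cast
    refine Finset.sum_congr rfl fun b _ => Finset.sum_congr rfl fun b' _ => ?_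
    by_cases h : θ b = θ b'
    · simp [h, hcomp b b' h, circleExp_zero]
    · simp [h, sub_eq_zero]
  rw [hval] at hlim
  have hlim' : Filter.Tendsto (fun M : ℕ => (∑ n ∈ Finset.range M,
      ‖∑ b ∈ s, (c b : ℂ) * circleExp (n • θ b - η b)‖ ^ 2) / (M : ℝ)) Filter.atTop
      (nhds (∑ b ∈ s, ∑ b' ∈ s, if θ b = θ b' then c b * c b' else 0)) := by
    have := (Complex.continuous_re.tendsto _).comp hlim
    rw [Complex.ofReal_re] at this
    refine this.congr fun M => ?_
    simp only [Function.comp_apply]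
    rw [← Complex.ofReal_re ((∑ n ∈ Finset.range M,
      ‖∑ b ∈ s, (c b : ℂ) * circleExp (n • θ b - η b)‖ ^ 2) / (M : ℝ))]
    congr 1
    rw [Complex.ofReal_div, Complex.ofReal_sum, Finset.sum_congr rfl fun n _ => hexp n]
    rw [Finset.sum_comm (s := Finset.range M), Finset.sum_div]
    refine Finset.sum_congr rfl fun b _ => ?_
    rw [Finset.sum_comm (s := Finset.range M), Finset.sum_div]
    refine Finset.sum_congr rfl fun b' _ => ?_
    rw [← Finset.mul_sum, mul_div_assoc, Complex.ofReal_natCast]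
  have hle : (∑ b ∈ s, ∑ b' ∈ s, if θ b = θ b' then c b * c b' else 0) ≤ K := by
    apply le_of_tendsto hlim'
    filter_upwards [Filter.eventually_gt_atTop 0] with M hM
    rw [div_le_iff₀ (by exact_mod_cast hM)]
    calc _ ≤ ∑ n ∈ Finset.range M, K := Finset.sum_le_sum fun n _ => hK n
      _ = K * M := by simp [mul_comm]
  refine le_trans (Finset.sum_le_sum fun b hb => ?_) hle
  calc c b ^ 2 = if θ b = θ b then c b * c b else 0 := by simp [sq]
    _ ≤ _ := Finset.single_le_sum (f := fun b' => if θ b = θ b' then c b * c b' else 0)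
      (fun b' _ => by split_ifs; exacts [mul_nonneg (hc _) (hc _), le_rfl]) hb

theorem norm_one_add_circleExp_lt {x : UnitAddCircle} (hx : x ≠ 0) : ‖1 + circleExp x‖ < 2 := by
  by_contra! h
  apply hx
  rw [← circleExp_eq_one_iff]
  have h1 : Complex.normSq (circleExp x) = 1 := by
    rw [Complex.normSq_eq_norm_sq, norm_circleExp]; norm_num
  have h2 : 4 ≤ Complex.normSq (1 + circleExp x) := by
    rw [Complex.normSq_eq_norm_sq]; nlinarith
  rw [Complex.normSq_apply] at h1 h2
  simp only [Complex.add_re, Complex.one_re, Complex.add_im, Complex.one_im, zero_add] at h2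
  have h3 : 1 ≤ (circleExp x).re := by nlinarith
  have h4 : (circleExp x).re ≤ 1 := by nlinarith [sq_nonneg (circleExp x).im]
  have h5 : (circleExp x).re = 1 := le_antisymm h4 h3
  apply Complex.ext
  · simp [h5]
  · rw [h5] at h1
    simpa using h1

theorem exists_norm_one_add_circleExp_le {ε : ℝ} (hε : 0 < ε) :
    ∃ θ : ℝ, 0 < θ ∧ θ < 1 ∧ ∀ x : UnitAddCircle, ε ≤ ‖x‖ → ‖1 + circleExp x‖ ≤ 2 * θ := by
  have hcont : Continuous fun x : UnitAddCircle => ‖1 + circleExp x‖ :=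
    (continuous_const.add continuous_circleExp).norm
  have hcpt : IsCompact {x : UnitAddCircle | ε ≤ ‖x‖} :=
    (isClosed_le continuous_const continuous_norm).isCompact
  rcases Set.eq_empty_or_nonempty {x : UnitAddCircle | ε ≤ ‖x‖} with he | hne
  · refine ⟨1 / 2, by norm_num, by norm_num, fun x hx => ?_⟩
    exact absurd (show x ∈ {x : UnitAddCircle | ε ≤ ‖x‖} from hx) (by simp [he])
  · obtain ⟨x₀, hx₀, hmax⟩ := hcpt.exists_isMaxOn hne hcont.continuousOn
    have hx₀' : ‖1 + circleExp x₀‖ < 2 := norm_one_add_circleExp_lt (by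
      rintro rfl
      simp only [Set.mem_ofPred_eq, norm_zero] at hx₀
      linarith)
    -- The `1 / 2` only keeps the constant positive.
    refine ⟨max (1 / 2) (‖1 + circleExp x₀‖ / 2), by positivity, ?_, fun x hx => ?_⟩
    · rw [max_lt_iff]; constructor <;> linarith
    · have h1 : ‖1 + circleExp x‖ ≤ ‖1 + circleExp x₀‖ := hmax hx
      have h2 := le_max_right (1 / 2) (‖1 + circleExp x₀‖ / 2)
      linarith

/-- **Kronecker's approximation theorem** on the circle. -/
theorem exists_zsmul_near {ι : Type*} [Fintype ι] (γ y : ι → UnitAddCircle)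
    (h : ∀ b : ι → ℤ, ∑ i, b i • γ i = 0 → ∑ i, b i • y i = 0) {ε : ℝ} (hε : 0 < ε) :
    ∃ n : ℤ, ∀ i, ‖n • γ i - y i‖ < ε := by
  classical
  by_contra! hcon
  obtain ⟨θ, hθ0, hθ1, hθ⟩ := exists_norm_one_add_circleExp_le hε
  set k := Fintype.card ι
  -- The product of the `(1 + circleExp (n • γ i - y i)) ^ L` would be near its maximum `2 ^ (k *
  -- L)` at a good `n`. If there is none, one factor is always at most `(2 * θ) ^ L`, which makes
  -- the mean square exponentially small. But the coefficients sum to `2 ^ (k * L)` over only `(L +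
  -- 1) ^ k` terms, so their squares cannot be that small.
  have key : ∀ L : ℕ, 1 ≤ ((L + 1 : ℕ) : ℝ) ^ k * (θ ^ 2) ^ L := by
    intro L
    let s : Finset (ι → ℕ) := Fintype.piFinset fun _ => Finset.range (L + 1)
    let c : (ι → ℕ) → ℝ := fun b => ∏ i, (L.choose (b i) : ℝ)
    have hF : ∀ n : ℕ, ∏ i, (1 + circleExp (n • γ i - y i)) ^ L =
        ∑ b ∈ s, (c b : ℂ) * circleExp (n • (∑ i, b i • γ i) - ∑ i, b i • y i) := by
      intro n
      have h1 : ∀ i, (1 + circleExp (n • γ i - y i)) ^ L = ∑ m ∈ Finset.range (L + 1),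
          (L.choose m : ℂ) * circleExp (m • (n • γ i - y i)) := by
        intro i
        rw [add_comm, add_pow]
        refine Finset.sum_congr rfl fun m _ => ?_
        rw [one_pow, mul_one, circleExp_nsmul, mul_comm]
      simp only [h1]
      rw [Finset.prod_univ_sum]
      refine Finset.sum_congr rfl fun b _ => ?_
      rw [Finset.prod_mul_distrib, ← circleExp_sum]
      simp only [c, Complex.ofReal_prod, Complex.ofReal_natCast]
      congr 2
      rw [Finset.smul_sum, ← Finset.sum_sub_distrib]
      refine Finset.sum_congr rfl fun i _ => ?_
      rw [smul_sub, smul_comm]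
    have hbd : ∑ b ∈ s, c b ^ 2 ≤ (4 : ℝ) ^ (k * L) * (θ ^ 2) ^ L := by
      refine sum_sq_le_of_norm_sq_le s c (fun b => Finset.prod_nonneg fun _ _ => by positivity)
        (fun b => ∑ i, b i • γ i) (fun b => ∑ i, b i • y i) (fun b b' hbb => ?_) _ (fun n => ?_)
      -- Relations among the `γ i` hold among the `y i`, so equal frequencies carry equal phases.
      · have := h (fun i => (b i : ℤ) - b' i) (by
          simp only [sub_smul, Finset.sum_sub_distrib, natCast_zsmul]
          exact sub_eq_zero.2 hbb)
        simp only [sub_smul, Finset.sum_sub_distrib, natCast_zsmul] at this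
        exact sub_eq_zero.1 this
      · rw [← hF, norm_prod]
        obtain ⟨i₀, hi₀⟩ := hcon n
        rw [natCast_zsmul] at hi₀
        have h2 : ∀ x, ‖1 + circleExp x‖ ≤ 2 := fun x =>
          (norm_add_le _ _).trans (by rw [norm_circleExp]; norm_num)
        have hle : ∏ i, ‖(1 + circleExp (n • γ i - y i)) ^ L‖ ≤ 2 ^ (k * L) * θ ^ L := by
          rw [← Finset.mul_prod_erase _ _ (Finset.mem_univ i₀)]
          have e1 : ‖(1 + circleExp (n • γ i₀ - y i₀)) ^ L‖ ≤ (2 * θ) ^ L := by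
            rw [norm_pow]
            exact pow_le_pow_left₀ (norm_nonneg _) (hθ _ hi₀) _
          have e2 : ∏ i ∈ Finset.univ.erase i₀, ‖(1 + circleExp (n • γ i - y i)) ^ L‖
              ≤ ∏ i ∈ Finset.univ.erase i₀, (2 : ℝ) ^ L :=
            Finset.prod_le_prod (fun _ _ => norm_nonneg _) fun i _ => by
              rw [norm_pow]
              exact pow_le_pow_left₀ (norm_nonneg _) (h2 _) _
          refine (mul_le_mul e1 e2 (Finset.prod_nonneg fun _ _ => norm_nonneg _)
            (by positivity)).trans (le_of_eq ?_)
          have hk : 2 ^ (k * L) = (2 : ℝ) ^ L * ∏ i ∈ Finset.univ.erase i₀, (2 : ℝ) ^ L := by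
            rw [Finset.mul_prod_erase Finset.univ (fun _ => (2 : ℝ) ^ L) (Finset.mem_univ i₀)]
            simp [k, ← pow_mul, mul_comm]
          rw [hk, mul_pow]
          ring
        calc _ ≤ (2 ^ (k * L) * θ ^ L) ^ 2 :=
              pow_le_pow_left₀ (Finset.prod_nonneg fun _ _ => norm_nonneg _) hle 2
          _ = _ := by
            rw [mul_pow, ← pow_mul, ← pow_mul, ← pow_mul, mul_comm (k * L) 2, pow_mul 2 2,
              mul_comm L 2]
            norm_num
    have hsum : ∑ b ∈ s, c b = 2 ^ (k * L) := by
      have := Finset.prod_univ_sum (fun _ : ι => Finset.range (L + 1))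
        (fun _ m => (L.choose m : ℝ))
      rw [← this]
      have h2 : ∑ m ∈ Finset.range (L + 1), (L.choose m : ℝ) = 2 ^ L := by
        exact_mod_cast Nat.sum_range_choose L
      simp [h2, k, ← pow_mul, mul_comm]
    have hcs := sq_sum_le_card_mul_sum_sq (s := s) (f := c)
    have hcard : (s.card : ℝ) = ((L + 1 : ℕ) : ℝ) ^ k := by
      simp [s, k]
    rw [hsum, hcard] at hcs
    have h4 : ((2 : ℝ) ^ (k * L)) ^ 2 = 4 ^ (k * L) := by
      rw [← pow_mul, mul_comm, pow_mul]; norm_num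
    rw [h4] at hcs
    have h5 : (4 : ℝ) ^ (k * L) * 1 ≤ 4 ^ (k * L) * (((L + 1 : ℕ) : ℝ) ^ k * (θ ^ 2) ^ L) := by
      calc _ ≤ ((L + 1 : ℕ) : ℝ) ^ k * ∑ b ∈ s, c b ^ 2 := by rw [mul_one]; exact hcs
        _ ≤ ((L + 1 : ℕ) : ℝ) ^ k * ((4 : ℝ) ^ (k * L) * (θ ^ 2) ^ L) := by gcongr
        _ = _ := by ring
    exact le_of_mul_le_mul_left h5 (by positivity)
  have hθ2 : |θ ^ 2| < 1 := by
    rw [abs_of_nonneg (by positivity)]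
    nlinarith
  have hlim := tendsto_pow_const_mul_const_pow_of_abs_lt_one k hθ2
  -- The threshold `θ ^ 2` rather than `1` absorbs the shift between the exponents `L + 1` and `L`.
  have hev := hlim.eventually (gt_mem_nhds (show (0 : ℝ) < θ ^ 2 by positivity))
  obtain ⟨n, hn1, hn2⟩ := (hev.and (Filter.eventually_ge_atTop 1)).exists
  obtain ⟨L, rfl⟩ := Nat.exists_eq_add_of_le hn2
  have := key L
  rw [add_comm 1 L, pow_succ] at hn1
  have h6 : (1 : ℝ) * θ ^ 2 ≤ (((L + 1 : ℕ) : ℝ) ^ k * (θ ^ 2) ^ L) * θ ^ 2 := by gcongr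
  linarith

/-! ### Integer independence in tori -/

/-- Adjoining `r` points to a linearly independent family in the circle keeps it independent,
after at most `r` members of the family have been discarded. -/
theorem exists_card_le_forall_eq_zero {κ : Type*} [Fintype κ] (α : κ → UnitAddCircle)
    (hα : LinearIndependent ℤ α) (r : ℕ) (β : Fin r → UnitAddCircle) :
    ∃ J : Finset κ, J.card ≤ r ∧ ∀ (c : Fin r → ℤ) (b : κ → ℤ), (∀ i ∈ J, b i = 0) →
      ∑ j, c j • β j + ∑ i, b i • α i = 0 → b = 0 := by
  classical
  induction r with
  | zero =>
    refine ⟨∅, by simp, fun c b _ h => ?_⟩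
    rw [Finset.univ_eq_empty, Finset.sum_empty, zero_add] at h
    exact funext (Fintype.linearIndependent_iff.1 hα b h)
  | succ r ih =>
    obtain ⟨J, hJ, hind⟩ := ih fun j => β j.succ
    by_cases H : ∀ (c : Fin (r + 1) → ℤ) (b : κ → ℤ), (∀ i ∈ J, b i = 0) →
      ∑ j, c j • β j + ∑ i, b i • α i = 0 → b = 0
    · exact ⟨J, hJ.trans (Nat.le_succ r), H⟩
    · push Not at H
      obtain ⟨c₀, b₀, hb₀, hs₀, hne⟩ := H
      obtain ⟨i₀, hi₀⟩ := Function.ne_iff.1 hne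
      refine ⟨insert i₀ J, (Finset.card_insert_le _ _).trans (Nat.succ_le_succ hJ),
        fun c b hb hs => ?_⟩
      -- Eliminate `β 0` between the given relation and the fixed one `(c₀, b₀)`. Evaluating the
      -- resulting identity at the discarded `i₀` forces `c 0 = 0`.
      have h1 : (fun i => c₀ 0 * b i - c 0 * b₀ i) = 0 := by
        apply hind (fun j => c₀ 0 * c j.succ - c 0 * c₀ j.succ)
        · intro i hi
          rw [hb i (Finset.mem_insert_of_mem hi), hb₀ i hi]
          ring
        · have : c₀ 0 • (∑ j, c j • β j + ∑ i, b i • α i)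
              - c 0 • (∑ j, c₀ j • β j + ∑ i, b₀ i • α i) = 0 := by rw [hs, hs₀]; simp
          rw [← this, Fin.sum_univ_succ, Fin.sum_univ_succ (fun j => c₀ j • β j)]
          simp only [sub_smul, Finset.sum_sub_distrib, smul_add, Finset.smul_sum, mul_smul]
          rw [smul_comm (c₀ 0) (c 0)]
          abel
      have h2 : c 0 = 0 := by
        have := congrFun h1 i₀
        simp only [hb i₀ (Finset.mem_insert_self _ _), mul_zero, zero_sub, Pi.zero_apply,
          neg_eq_zero, mul_eq_zero] at this
        exact this.resolve_right hi₀
      apply hind (fun j => c j.succ) b fun i hi => hb i (Finset.mem_insert_of_mem hi)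
      rw [Fin.sum_univ_succ, h2, zero_smul, zero_add] at hs
      exact hs

/-- Linearly independent families are dense in a finite-dimensional torus. -/
theorem dense_linearIndependent_int (κ : Type*) [Fintype κ] :
    Dense {α : κ → UnitAddCircle | LinearIndependent ℤ α} := by
  classical
  have hset : {α : κ → UnitAddCircle | LinearIndependent ℤ α} =
      ⋂ b : {b : κ → ℤ // b ≠ 0}, {α | ∑ i, b.1 i • α i = 0}ᶜ := by
    ext α
    simp only [Set.mem_ofPred_eq, Fintype.linearIndependent_iff, Set.mem_iInter,
      Set.mem_compl_iff, Subtype.forall]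
    constructor
    · intro h b hb hs
      exact hb (funext (h b hs))
    · intro h b hs
      by_contra hne
      exact h b (fun hb => hne fun i => congrFun hb i) hs
  rw [hset]
  -- Baire category: each nontrivial relation cuts out a closed set with empty interior.
  refine dense_iInter_of_isOpen (fun b => ?_) fun ⟨b, hb⟩ => ?_
  · refine (isClosed_eq ?_ continuous_const).isOpen_compl
    exact continuous_finsetSum _ fun i _ => (continuous_apply i).zsmul _
  · obtain ⟨i, hi⟩ := Function.ne_iff.1 hb
    rw [← interior_eq_empty_iff_dense_compl, Set.eq_empty_iff_forall_notMem]
    intro α hα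
    have hcont : Continuous fun s : ℝ => Function.update α i (α i + (s : UnitAddCircle)) :=
      continuous_const.update i (continuous_const.add (AddCircle.continuous_mk' 1))
    have hmem : ∀ᶠ s : ℝ in nhds 0, Function.update α i (α i + (s : UnitAddCircle)) ∈
        {α : κ → UnitAddCircle | ∑ i, b i • α i = 0} := by
      apply hcont.continuousAt.eventually_mem
      rw [mem_interior_iff_mem_nhds] at hα
      simpa using hα
    have hbi : 0 < |(b i : ℝ)| := abs_pos.2 (by exact_mod_cast hi)
    obtain ⟨δ, hδ, hball⟩ := Metric.eventually_nhds_iff.1 hmem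
    -- Small enough that `b i * s` has absolute value at most `1 / 2`, hence is nonzero in the
    -- circle.
    set s : ℝ := min (δ / 2) (1 / (2 * |(b i : ℝ)|)) with hs
    have hs0 : 0 < s := lt_min (by positivity) (by positivity)
    have hsδ : s < δ := (min_le_left _ _).trans_lt (by linarith)
    have h1 := hball (y := s) (by rw [Real.dist_eq, sub_zero, abs_of_pos hs0]; exact hsδ)
    have h0 : α ∈ {α : κ → UnitAddCircle | ∑ i, b i • α i = 0} := interior_subset hα
    rw [Set.mem_ofPred_eq] at h0
    have h2 : b i • (s : UnitAddCircle) = 0 := by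
      rw [Set.mem_ofPred_eq, ← Finset.add_sum_erase _ _ (Finset.mem_univ i)] at h1
      rw [← Finset.add_sum_erase _ _ (Finset.mem_univ i)] at h0
      rw [Function.update_self, Finset.sum_congr rfl fun j hj => by
        rw [Function.update_of_ne (Finset.ne_of_mem_erase hj)], smul_add] at h1
      have := sub_eq_zero.2 (h1.trans h0.symm)
      rw [← this]
      abel
    rw [← AddCircle.coe_zsmul, ← norm_eq_zero, zsmul_eq_mul,
      (AddCircle.norm_coe_eq_abs_iff 1 one_ne_zero).2, abs_mul, abs_of_pos hs0] at h2
    · exact (mul_pos hbi hs0).ne' h2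
    · rw [abs_mul, abs_of_pos hs0, abs_one]
      calc |(b i : ℝ)| * s ≤ |(b i : ℝ)| * (1 / (2 * |(b i : ℝ)|)) := by
            gcongr; exact min_le_right _ _
        _ = 1 / 2 := by field_simp

/-! ### Anticoncentration of letter counts -/

theorem ZMod.eq_zero_of_add_self_eq_zero {p : ℕ} {r : ZMod (2 * p + 1)} (h : r + r = 0) :
    r = 0 := by
  have h1 : ((2 * p + 1 : ℕ) : ZMod (2 * p + 1)) = 0 := ZMod.natCast_self _
  push_cast at h1
  calc r = (p + 1) * (r + r) - (2 * p + 1) * r := by ring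
    _ = 0 := by rw [h, h1]; ring

theorem AddChar.map_finsetSum {G M ι : Type*} [AddCommMonoid G] [CommMonoid M]
    (ψ : AddChar G M) (s : Finset ι) (f : ι → G) : ψ (∑ i ∈ s, f i) = ∏ i ∈ s, ψ (f i) := by
  classical
  induction s using Finset.induction_on with
  | empty => simp
  | insert a s ha ih => rw [Finset.sum_insert ha, Finset.prod_insert ha, ψ.map_add_eq_mul, ih]

theorem norm_add_lt_two_of_ne {z w : ℂ} (hz : ‖z‖ = 1) (hw : ‖w‖ = 1) (h : z ≠ w) :
    ‖z + w‖ < 2 := by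
  have h1 := parallelogram_law_with_norm ℝ z w
  have h2 : 0 < ‖z - w‖ := norm_pos_iff.2 (sub_ne_zero.2 h)
  rw [hz, hw] at h1
  by_contra! h3
  nlinarith

section Anticoncentration

variable {K : Type*} [Fintype K]

/-- The words of length `d` in which the sum of the weights `X` is `t` modulo `m` are counted by
the characters of `ℤ/m`. -/
theorem card_sum_weight_mul_le (m : ℕ) [NeZero m] (X : K → ℤ) (d : ℕ) (t : ZMod m) :
    ((Finset.univ.filter fun x : Fin d → K => ((∑ i, X (x i) : ℤ) : ZMod m) = t).card : ℝ) * m ≤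
      ∑ r : ZMod m, ‖∑ u, ZMod.stdAddChar (r * (X u : ZMod m))‖ ^ d := by
  classical
  have key : (((Finset.univ.filter fun x : Fin d → K =>
      ((∑ i, X (x i) : ℤ) : ZMod m) = t).card : ℂ)) * m =
      ∑ r : ZMod m, ZMod.stdAddChar (-(r * t)) *
        (∑ u, ZMod.stdAddChar (r * (X u : ZMod m))) ^ d := by
    have h1 : ∀ r : ZMod m, (∑ u, ZMod.stdAddChar (r * (X u : ZMod m))) ^ d =
        ∑ x : Fin d → K, ZMod.stdAddChar (r * ((∑ i, X (x i) : ℤ) : ZMod m)) := by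
      intro r
      rw [Fintype.sum_pow]
      refine Finset.sum_congr rfl fun x _ => ?_
      rw [Int.cast_sum, Finset.mul_sum, AddChar.map_finsetSum]
    simp only [h1, Finset.mul_sum]
    rw [Finset.sum_comm]
    have h2 : ∀ x : Fin d → K, ∑ r : ZMod m, ZMod.stdAddChar (-(r * t)) *
        ZMod.stdAddChar (r * ((∑ i, X (x i) : ℤ) : ZMod m)) =
        if ((∑ i, X (x i) : ℤ) : ZMod m) = t then (m : ℂ) else 0 := by
      intro x
      have h3 := AddChar.sum_mulShift (((∑ i, X (x i) : ℤ) : ZMod m) - t)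
        (ZMod.isPrimitive_stdAddChar m)
      rw [ZMod.card] at h3
      simp only [sub_eq_zero] at h3
      rw [← Nat.cast_zero, ← Nat.cast_ite, ← h3]
      refine Finset.sum_congr rfl fun r _ => ?_
      rw [← AddChar.map_add_eq_mul]
      congr 1
      ring
    simp only [h2]
    rw [← Finset.sum_filter, Finset.sum_const, nsmul_eq_mul]
  calc _ = ‖(((Finset.univ.filter fun x : Fin d → K =>
      ((∑ i, X (x i) : ℤ) : ZMod m) = t).card : ℂ)) * m‖ := by
        rw [norm_mul, Complex.norm_natCast, Complex.norm_natCast]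
    _ ≤ _ := by
        rw [key]
        refine (norm_sum_le _ _).trans (Finset.sum_le_sum fun r _ => ?_)
        rw [norm_mul, AddChar.norm_apply, one_mul, norm_pow]

variable [DecidableEq K]

/-- How often the letter `v` occurs in the word `x`. -/
def letterCount {d : ℕ} (x : Fin d → K) (v : K) : ℕ := (Finset.univ.filter fun i => x i = v).card

/-- The difference of the two counts is a random walk with steps `1`, `-1` and `0`. Modulo a large
odd `m` it equidistributes, so each residue takes at most a share `2 / m` of the words, and only `2
* k + 1` residues matter. -/
theorem eventually_card_letterCount_close_le {v w : K} (hvw : v ≠ w) (k : ℕ) {η : ℝ} (hη : 0 < η) :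
    ∀ᶠ d : ℕ in Filter.atTop, ((Finset.univ.filter fun x : Fin d → K =>
      |(letterCount x v : ℤ) - letterCount x w| ≤ k).card : ℝ) ≤ η * (Fintype.card K : ℝ) ^ d := by
  classical
  have hK : 0 < (Fintype.card K : ℝ) := by exact_mod_cast Fintype.card_pos_iff.2 ⟨v⟩
  obtain ⟨p, hp⟩ := exists_nat_gt ((2 * k + 1 : ℝ) * 2 / η)
  -- Oddness makes every nontrivial character separate the weights `1` and `-1`, so its sum over the
  -- alphabet is strictly smaller than the number of letters.
  set m := 2 * p + 1 with hm
  let X : K → ℤ := fun u => (if u = v then 1 else 0) - if u = w then 1 else 0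
  have hX : ∀ (d : ℕ) (x : Fin d → K),
      ∑ i, X (x i) = (letterCount x v : ℤ) - letterCount x w := by
    intro d x
    simp [X, letterCount, Finset.sum_sub_distrib]
  have hlt : ∀ r : ZMod m, r ≠ 0 →
      ‖∑ u, ZMod.stdAddChar (r * (X u : ZMod m))‖ < Fintype.card K := by
    intro r hr
    have hv : X v = 1 := by simp [X, hvw]
    have hw : X w = -1 := by simp [X, hvw.symm]
    rw [← Finset.add_sum_erase _ _ (Finset.mem_univ v),
      ← Finset.add_sum_erase _ _ (Finset.mem_erase.2 ⟨hvw.symm, Finset.mem_univ w⟩), ← add_assoc]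
    refine (norm_add_le _ _).trans_lt ?_
    have h1 : ‖(ZMod.stdAddChar (r * (X v : ZMod m)) : ℂ) +
        ZMod.stdAddChar (r * (X w : ZMod m))‖ < 2 := by
      refine norm_add_lt_two_of_ne (AddChar.norm_apply _ _) (AddChar.norm_apply _ _) fun h => hr ?_
      have := ZMod.injective_stdAddChar h
      rw [hv, hw] at this
      apply ZMod.eq_zero_of_add_self_eq_zero
      push_cast at this
      linear_combination this
    have h2 : ‖∑ u ∈ (Finset.univ.erase v).erase w, (ZMod.stdAddChar (r * (X u : ZMod m)) : ℂ)‖ ≤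
        Fintype.card K - 2 := by
      refine (norm_sum_le _ _).trans (le_of_eq ?_)
      simp only [AddChar.norm_apply, Finset.sum_const, nsmul_eq_mul, mul_one]
      rw [Finset.card_erase_of_mem (Finset.mem_erase.2 ⟨hvw.symm, Finset.mem_univ w⟩),
        Finset.card_erase_of_mem (Finset.mem_univ v), Finset.card_univ, Nat.sub_sub,
        Nat.cast_sub]
      · norm_num
      · exact Fintype.one_lt_card_iff.2 ⟨v, w, hvw⟩
    linarith
  have hlim : Filter.Tendsto (fun d : ℕ => ∑ r ∈ Finset.univ.erase (0 : ZMod m),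
      (‖∑ u, ZMod.stdAddChar (r * (X u : ZMod m))‖ / Fintype.card K) ^ d)
      Filter.atTop (nhds 0) := by
    have h0 : (0 : ℝ) = ∑ _r ∈ Finset.univ.erase (0 : ZMod m), (0 : ℝ) := by simp
    refine (congrArg nhds h0).symm ▸ tendsto_finsetSum _ fun r hr => tendsto_pow_atTop_nhds_zero_of_lt_one (by positivity) ?_
    rw [div_lt_one hK]
    exact hlt r (Finset.ne_of_mem_erase hr)
  filter_upwards [hlim.eventually (gt_mem_nhds zero_lt_one)] with d hd
  have hfib : ∀ t : ZMod m, ((Finset.univ.filter fun x : Fin d → K =>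
      ((∑ i, X (x i) : ℤ) : ZMod m) = t).card : ℝ) ≤ 2 * (Fintype.card K : ℝ) ^ d / m := by
    intro t
    rw [le_div_iff₀ (by positivity)]
    refine (card_sum_weight_mul_le m X d t).trans ?_
    rw [← Finset.add_sum_erase _ _ (Finset.mem_univ 0)]
    have h0 : ‖∑ u, (ZMod.stdAddChar (0 * (X u : ZMod m)) : ℂ)‖ = Fintype.card K := by
      simp
    rw [h0]
    have h1 : ∑ r ∈ Finset.univ.erase (0 : ZMod m),
        ‖∑ u, (ZMod.stdAddChar (r * (X u : ZMod m)) : ℂ)‖ ^ d ≤ (Fintype.card K : ℝ) ^ d := by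
      simp only [div_pow] at hd
      rw [← Finset.sum_div, div_lt_one (by positivity)] at hd
      exact hd.le
    linarith
  have hsub : (Finset.univ.filter fun x : Fin d → K =>
      |(letterCount x v : ℤ) - letterCount x w| ≤ k) ⊆
      (Finset.Icc (-(k : ℤ)) k).biUnion fun t => Finset.univ.filter fun x : Fin d → K =>
        ((∑ i, X (x i) : ℤ) : ZMod m) = t := by
    intro x hx
    rw [Finset.mem_filter] at hx
    rw [Finset.mem_biUnion]
    refine ⟨(letterCount x v : ℤ) - letterCount x w, Finset.mem_Icc.2 (abs_le.1 hx.2), ?_⟩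
    rw [Finset.mem_filter, hX]
    exact ⟨Finset.mem_univ _, rfl⟩
  calc _ ≤ ∑ t ∈ Finset.Icc (-(k : ℤ)) k, ((Finset.univ.filter fun x : Fin d → K =>
        ((∑ i, X (x i) : ℤ) : ZMod m) = t).card : ℝ) := by
        exact_mod_cast (Finset.card_le_card hsub).trans Finset.card_biUnion_le
    _ ≤ ∑ t ∈ Finset.Icc (-(k : ℤ)) k, 2 * (Fintype.card K : ℝ) ^ d / m :=
        Finset.sum_le_sum fun t _ => hfib t
    _ = ((2 * k + 1 : ℝ) * 2 / m) * (Fintype.card K : ℝ) ^ d := by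
        rw [Finset.sum_const, Int.card_Icc, nsmul_eq_mul,
          show (k + 1 - -(k : ℤ)).toNat = 2 * k + 1 by omega]
        push_cast
        ring
    _ ≤ η * (Fintype.card K : ℝ) ^ d := by
        gcongr
        rw [div_le_iff₀ (by positivity)]
        rw [div_lt_iff₀ hη] at hp
        have : (m : ℝ) = 2 * p + 1 := by rw [hm]; push_cast; ring
        rw [this]
        nlinarith [(Nat.cast_nonneg p : (0 : ℝ) ≤ p)]

/-- The words of length `d` in which the letter `v` leads every other one by more than `k`. -/
def leadingWords (d k : ℕ) (v : K) : Finset (Fin d → K) :=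
  Finset.univ.filter fun x => ∀ w, w ≠ v → letterCount x w + k < letterCount x v

theorem mem_leadingWords {d k : ℕ} {v : K} {x : Fin d → K} :
    x ∈ leadingWords d k v ↔ ∀ w, w ≠ v → letterCount x w + k < letterCount x v := by
  simp [leadingWords]

theorem eq_of_mem_leadingWords {d k k' : ℕ} {v v' : K} {x : Fin d → K}
    (h : x ∈ leadingWords d k v) (h' : x ∈ leadingWords d k' v') : v = v' := by
  by_contra hne
  have h1 := mem_leadingWords.1 h v' (Ne.symm hne)
  have h2 := mem_leadingWords.1 h' v hne
  omega

/-- A word without a clear leader has a most frequent letter and another one within `k` of it. A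
union bound over pairs of letters finishes. -/
theorem eventually_le_sum_card_leadingWords [Nonempty K] (k : ℕ) {η : ℝ} (hη : 0 < η) :
    ∀ᶠ d : ℕ in Filter.atTop, (1 - η) * (Fintype.card K : ℝ) ^ d ≤
      ∑ v : K, ((leadingWords d k v).card : ℝ) := by
  classical
  have hK : 0 < (Fintype.card K : ℝ) := by exact_mod_cast Fintype.card_pos
  let P : Finset (K × K) := Finset.univ.filter fun p => p.1 ≠ p.2
  have hall : ∀ᶠ d : ℕ in Filter.atTop, ∀ p ∈ P, ((Finset.univ.filter fun x : Fin d → K =>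
      |(letterCount x p.1 : ℤ) - letterCount x p.2| ≤ k).card : ℝ) ≤
        (η / (P.card + 1)) * (Fintype.card K : ℝ) ^ d := by
    rw [Filter.eventually_all_finset]
    intro p hp
    exact eventually_card_letterCount_close_le (Finset.mem_filter.1 hp).2 k (by positivity)
  filter_upwards [hall] with d hd
  have hcover : (Finset.univ : Finset (Fin d → K)) ⊆
      (Finset.univ.biUnion fun v : K => leadingWords d k v) ∪
        P.biUnion fun p => Finset.univ.filter fun x : Fin d → K =>
          |(letterCount x p.1 : ℤ) - letterCount x p.2| ≤ k := by
    intro x _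
    obtain ⟨v, -, hv⟩ := Finset.exists_max_image Finset.univ (letterCount x) Finset.univ_nonempty
    rw [Finset.mem_union]
    by_cases h : x ∈ leadingWords d k v
    · exact Or.inl (Finset.mem_biUnion.2 ⟨v, Finset.mem_univ v, h⟩)
    · rw [mem_leadingWords] at h
      push Not at h
      obtain ⟨w, hwv, hw⟩ := h
      refine Or.inr (Finset.mem_biUnion.2 ⟨(v, w), ?_, ?_⟩)
      · simp [P, hwv.symm]
      · have := hv w (Finset.mem_univ w)
        rw [Finset.mem_filter, abs_le]
        refine ⟨Finset.mem_univ _, ?_, ?_⟩ <;> dsimp only <;> omega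
  have hcard : ((Fintype.card K : ℝ)) ^ d ≤ ∑ v : K, ((leadingWords d k v).card : ℝ) +
      ∑ p ∈ P, ((Finset.univ.filter fun x : Fin d → K =>
        |(letterCount x p.1 : ℤ) - letterCount x p.2| ≤ k).card : ℝ) := by
    have h1 := (Finset.card_le_card hcover).trans (Finset.card_union_le _ _)
    have h2 := h1.trans (add_le_add Finset.card_biUnion_le Finset.card_biUnion_le)
    rw [Finset.card_univ, Fintype.card_fun, Fintype.card_fin] at h2
    exact_mod_cast h2
  have hsum := Finset.sum_le_sum hd
  rw [Finset.sum_const, nsmul_eq_mul] at hsum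
  have : (P.card : ℝ) * (η / (P.card + 1) * (Fintype.card K : ℝ) ^ d) ≤
      η * (Fintype.card K : ℝ) ^ d := by
    rw [← mul_assoc]
    gcongr
    rw [mul_div_assoc', div_le_iff₀ (by positivity)]
    nlinarith
  linarith

end Anticoncentration

theorem letterCount_add_right {N d : ℕ} [NeZero N] (x : Fin d → ZMod N) (g v : ZMod N) :
    letterCount (fun i => x i + g) (v + g) = letterCount x v := by
  simp [letterCount]

theorem card_leadingWords_eq {N : ℕ} [NeZero N] (d k : ℕ) (v : ZMod N) :
    (leadingWords d k v).card = (leadingWords d k (0 : ZMod N)).card := by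
  symm
  refine Finset.card_bij' (fun x _ i => x i + v) (fun x _ i => x i + -v) ?_ ?_ ?_ ?_
  · intro x hx
    rw [mem_leadingWords] at hx ⊢
    intro w hw
    have h1 := hx (w - v) (sub_ne_zero.2 hw)
    rw [← letterCount_add_right x v, ← letterCount_add_right x v] at h1
    simpa using h1
  · intro x hx
    rw [mem_leadingWords] at hx ⊢
    intro w hw
    have h1 := hx (w + v) (by simpa using hw)
    rw [← letterCount_add_right x (-v), ← letterCount_add_right x (-v)] at h1
    simpa using h1
  · intro x _; funext i; simp
  · intro x _; funext i; simp

/-- Translating the alphabet shows that all letters lead equally many words, so words led by `A`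
have a share close to `A.card / N`. The strictness of `hA` leaves room for the leaderless words. -/
theorem exists_lt_card_biUnion_leadingWords {N : ℕ} [NeZero N] (A : Finset (ZMod N)) {c : ℝ}
    (hA : c * N < A.card) (k : ℕ) :
    ∃ d : ℕ, c * (N : ℝ) ^ d < (A.biUnion fun v => leadingWords d k v).card := by
  have hN : 0 < (N : ℝ) := by exact_mod_cast Nat.pos_of_ne_zero (NeZero.ne N)
  set η : ℝ := (A.card - c * N) / (2 * (A.card + 1)) with hη
  have hη0 : 0 < η := div_pos (by linarith) (by positivity)
  obtain ⟨d, hd⟩ := (eventually_le_sum_card_leadingWords (K := ZMod N) k hη0).exists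
  refine ⟨d, ?_⟩
  rw [Finset.card_biUnion]
  · simp only [card_leadingWords_eq] at hd ⊢
    rw [Finset.sum_const, Finset.card_univ, ZMod.card, nsmul_eq_mul] at hd
    rw [Finset.sum_const, smul_eq_mul, Nat.cast_mul]
    set W : ℝ := ((leadingWords d k (0 : ZMod N)).card : ℝ)
    have h1 : η * A.card < A.card - c * N := by
      rw [hη, div_mul_eq_mul_div, div_lt_iff₀ (by positivity)]
      nlinarith [(Nat.cast_nonneg A.card : (0 : ℝ) ≤ A.card)]
    have h2 : (A.card : ℝ) * ((1 - η) * (N : ℝ) ^ d) ≤ A.card * (N * W) := by gcongr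
    have h3 : c * N * (N : ℝ) ^ d < (A.card * (1 - η)) * (N : ℝ) ^ d :=
      mul_lt_mul_of_pos_right (by linarith) (by positivity)
    have h4 : N * (c * (N : ℝ) ^ d) < N * (A.card * W) := by linarith
    exact lt_of_mul_lt_mul_left h4 hN.le
  · intro v _ w _ hvw
    rw [Function.onFun, Finset.disjoint_left]
    intro x hx hx'
    exact hvw (eq_of_mem_leadingWords hx hx')

/-! ### Avoiding sets in cyclic groups -/

/-- Some `A ⊆ ℤ/N` of density greater than `c` is disjoint from all its translates by elements
of `E`. -/
def HasAvoidingSet (c : ℝ) (E : Set ℤ) : Prop :=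
  ∃ (N : ℕ) (_ : NeZero N) (A : Finset (ZMod N)), c * N < A.card ∧
    ∀ e ∈ E, ∀ a ∈ A, a + (e : ZMod N) ∉ A

theorem HasAvoidingSet.mono {c : ℝ} {E F : Set ℤ} (h : HasAvoidingSet c F) (hEF : E ⊆ F) :
    HasAvoidingSet c E := by
  obtain ⟨N, hN, A, hA, hF⟩ := h
  exact ⟨N, hN, A, hA, fun e he => hF e (hEF he)⟩

theorem exists_hasAvoidingSet_of_zero_notMem (F : Finset ℤ) (h0 : (0 : ℤ) ∉ F) :
    ∃ c : ℝ, 0 < c ∧ HasAvoidingSet c F := by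
  obtain ⟨R, hR⟩ : ∃ R : ℕ, ∀ f ∈ F, |f| < R := by
    refine ⟨∑ f ∈ F, f.natAbs + 1, fun f hf => ?_⟩
    have : f.natAbs ≤ ∑ f ∈ F, f.natAbs :=
      Finset.single_le_sum (f := fun f : ℤ => f.natAbs) (fun _ _ => Nat.zero_le _) hf
    rw [Int.abs_eq_natAbs]
    omega
  -- A single point of a cyclic group longer than every `|f|`; halving its density makes the
  -- inequality strict.
  refine ⟨1 / (2 * (R + 1)), by positivity, R + 1, inferInstance, {0}, ?_, ?_⟩
  · push_cast
    rw [Finset.card_singleton, div_mul_eq_mul_div, div_lt_iff₀ (by positivity)]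
    push_cast
    linarith [(Nat.cast_nonneg R : (0 : ℝ) ≤ R)]
  · intro f hf a ha
    rw [Finset.mem_singleton] at ha ⊢
    rw [ha, zero_add, ZMod.intCast_zmod_eq_zero_iff_dvd]
    intro hdvd
    have := Int.eq_zero_of_abs_lt_dvd hdvd (by push_cast; linarith [hR f hf])
    exact h0 (this ▸ hf)

/-- If the fractional parts of `t + l / L` and `t + l' / L` are both within `1 / (2L)` of an
integer, where `0 ≤ l, l' < L`, then `l = l'`. -/
theorem eq_of_fract_near_int {L l l' : ℕ} (hl : l < L) (hl' : l' < L) {t ρ : ℝ}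
    (hρ : ρ = 1 / (2 * L)) (h : ¬ (ρ ≤ Int.fract (t + l / L) ∧ Int.fract (t + l / L) ≤ 1 - ρ))
    (h' : ¬ (ρ ≤ Int.fract (t + l' / L) ∧ Int.fract (t + l' / L) ≤ 1 - ρ)) : l = l' := by
  have hL : (0 : ℝ) < L := by exact_mod_cast Nat.zero_lt_of_lt hl
  have near : ∀ s : ℝ, ¬ (ρ ≤ Int.fract s ∧ Int.fract s ≤ 1 - ρ) → ∃ z : ℤ, |s - z| < ρ := by
    intro s hs
    rw [not_and_or, not_le, not_le] at hs
    rcases hs with hs | hs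
    · exact ⟨⌊s⌋, by rwa [Int.self_sub_floor, abs_of_nonneg (Int.fract_nonneg s)]⟩
    · refine ⟨⌊s⌋ + 1, ?_⟩
      have h1 := Int.fract_lt_one s
      have h2 := Int.self_sub_floor s
      push_cast
      rw [abs_lt]
      constructor <;> linarith [Int.fract_nonneg s]
  obtain ⟨z, hz⟩ := near _ h
  obtain ⟨z', hz'⟩ := near _ h'
  have hLρ : 2 * (L * ρ) = 1 := by rw [hρ]; field_simp
  rw [abs_lt] at hz hz'
  have e1 : L * (t + l / L - z) = L * t + l - L * z := by field_simp
  have e2 : L * (t + l' / L - z') = L * t + l' - L * z' := by field_simp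
  have b1 := mul_lt_mul_of_pos_left hz.1 hL
  have b2 := mul_lt_mul_of_pos_left hz.2 hL
  have b3 := mul_lt_mul_of_pos_left hz'.1 hL
  have b4 := mul_lt_mul_of_pos_left hz'.2 hL
  rw [e1] at b1 b2
  rw [e2] at b3 b4
  have k1 : ((l : ℤ) - l' - L * (z - z') : ℝ) < 1 := by push_cast; linarith
  have k2 : (-1 : ℝ) < ((l : ℤ) - l' - L * (z - z') : ℝ) := by push_cast; linarith
  have k1' : (l : ℤ) - l' - L * (z - z') < 1 := by exact_mod_cast k1
  have k2' : -1 < (l : ℤ) - l' - L * (z - z') := by exact_mod_cast k2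
  have hdvd : (L : ℤ) ∣ (l : ℤ) - l' := ⟨z - z', by linarith⟩
  have := Int.eq_zero_of_abs_lt_dvd hdvd (by rw [abs_lt]; constructor <;> omega)
  omega

theorem floor_add_eq_of_fract {s δ ρ : ℝ} (g : ℤ) (h1 : ρ ≤ Int.fract s)
    (h2 : Int.fract s ≤ 1 - ρ) (hδ : |δ| < ρ) : ⌊s + g + δ⌋ = ⌊s⌋ + g := by
  rw [abs_lt] at hδ
  have h3 := Int.self_sub_floor s
  rw [Int.floor_eq_iff]
  push_cast
  constructor <;> linarith

/-- If each `f ∈ F` moves all but at most `k` of the coordinates of the torus rotation by `α`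
approximately as some `g ∈ E` moves `ℤ/N`, then an avoiding set for `E` gives one for `F`: take
the points whose coordinates have, robustly, their most frequent value in the given set. -/
theorem HasAvoidingSet.exists_extension {c : ℝ} {E : Set ℤ} (h : HasAvoidingSet c E) (k : ℕ) :
    ∃ (N d : ℕ) (ε : ℝ), 0 < ε ∧ ∀ (α : Fin d → UnitAddCircle) (F : Finset ℤ),
      (∀ f ∈ F, ∃ g ∈ E, (Finset.univ.filter fun i =>
        ε ≤ ‖f • α i - (((g : ℝ) / N : ℝ) : UnitAddCircle)‖).card ≤ k) →
      HasAvoidingSet c (F : Set ℤ) := by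
  classical
  obtain ⟨N, hN, A, hA, hE⟩ := h
  obtain ⟨d, hd⟩ := exists_lt_card_biUnion_leadingWords A hA (2 * k)
  set C := A.biUnion fun v => leadingWords d (2 * k) v with hC
  have hN0 : (0 : ℝ) < N := by exact_mod_cast Nat.pos_of_ne_zero (NeZero.ne N)
  -- `L` is the number of grid offsets. At most `d` of them put some coordinate too close to an
  -- integer, so `L` is taken large enough that losing them keeps the density `θ` above `c`.
  obtain ⟨L, hL⟩ := exists_nat_gt ((d * C.card : ℝ) / (C.card - c * (N : ℝ) ^ d))
  rw [div_lt_iff₀ (by linarith)] at hL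
  have hL0 : 0 < (L : ℝ) := by
    rcases Nat.eq_zero_or_pos L with h0 | h0
    · rw [h0] at hL
      have : (0 : ℝ) ≤ d * C.card := by positivity
      simp only [Nat.cast_zero, zero_mul] at hL
      linarith
    · exact_mod_cast h0
  set ρ : ℝ := 1 / (2 * L) with hρ
  refine ⟨N, d, ρ / N, by positivity, fun α F hF => ?_⟩
  choose a ha using fun i => QuotientAddGroup.mk_surjective (s := AddSubgroup.zmultiples (1 : ℝ))
    (α i)
  have ha' : ∀ i, α i = ((a i : ℝ) : UnitAddCircle) := fun i => (ha i).symm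
  obtain ⟨R, hR⟩ : ∃ R : ℕ, ∀ f ∈ F, |f| ≤ R := by
    refine ⟨∑ f ∈ F, f.natAbs, fun f hf => ?_⟩
    have : f.natAbs ≤ ∑ f ∈ F, f.natAbs :=
      Finset.single_le_sum (f := fun f : ℤ => f.natAbs) (fun _ _ => Nat.zero_le _) hf
    rw [Int.abs_eq_natAbs]
    omega
  set θ : ℝ := (L - d) * C.card / (L * (N : ℝ) ^ d) with hθ
  have hcθ : c < θ := by
    rw [hθ, lt_div_iff₀ (by positivity)]
    linarith
  obtain ⟨M', hM'⟩ := exists_nat_gt (c * R / (θ - c))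
  rw [div_lt_iff₀ (by linarith)] at hM'
  -- The set will live in `[0, M)` inside `ℤ/(M + R)`. The gap of length `R` prevents wrap-around
  -- and costs little density.
  obtain ⟨M, hM0, hM⟩ : ∃ M : ℕ, 0 < M ∧ c * (M + R : ℝ) < θ * M := by
    refine ⟨M' + 1, Nat.succ_pos _, ?_⟩
    push_cast
    linarith
  let pos : ℕ → ℕ → Fin d → ℝ := fun l n i => N * (n * a i) + l / L
  let good : ℕ → ℕ → Prop := fun l n =>
    ∀ i, ρ ≤ Int.fract (pos l n i) ∧ Int.fract (pos l n i) ≤ 1 - ρ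
  let col : ℕ → ℕ → (Fin d → ZMod N) := fun l n i => ((⌊pos l n i⌋ : ℤ) : ZMod N)
  let B : ℕ → (Fin d → ZMod N) → Finset ℕ := fun l x =>
    (Finset.range M).filter fun n => good l n ∧ x + col l n ∈ C
  have hgood : ∀ n : ℕ, (L : ℝ) - d ≤ ((Finset.range L).filter fun l => good l n).card := by
    intro n
    have h1 : (Finset.range L).filter (fun l => ¬ good l n) ⊆
        Finset.univ.biUnion fun i : Fin d => (Finset.range L).filter fun l =>
          ¬ (ρ ≤ Int.fract (pos l n i) ∧ Int.fract (pos l n i) ≤ 1 - ρ) := by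
      intro l hl
      rw [Finset.mem_filter] at hl
      obtain ⟨i, hi⟩ := not_forall.1 hl.2
      exact Finset.mem_biUnion.2 ⟨i, Finset.mem_univ i, Finset.mem_filter.2 ⟨hl.1, hi⟩⟩
    have h2 : ((Finset.range L).filter fun l => ¬ good l n).card ≤ d := by
      refine (Finset.card_le_card h1).trans (Finset.card_biUnion_le.trans ?_)
      calc _ ≤ ∑ _i : Fin d, 1 := Finset.sum_le_sum fun i _ => by
            rw [Finset.card_le_one]
            intro l hl l' hl'
            rw [Finset.mem_filter, Finset.mem_range] at hl hl'
            exact eq_of_fract_near_int hl.1 hl'.1 hρ hl.2 hl'.2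
        _ = d := by simp
    have h3 := Finset.card_filter_add_card_filter_not (s := Finset.range L) (fun l => good l n)
    rw [Finset.card_range] at h3
    have h4 : (L : ℝ) = ((Finset.range L).filter fun l => good l n).card +
      ((Finset.range L).filter fun l => ¬ good l n).card := by exact_mod_cast h3.symm
    have h5 : (((Finset.range L).filter fun l => ¬ good l n).card : ℝ) ≤ d := by
      exact_mod_cast h2
    linarith
  -- Double counting over offsets `l` and word translations `x`: for each `n` and each good `l`,
  -- exactly `C.card` of the `x` bring the word of `n` into `C`.
  have hcount : (M : ℝ) * ((L - d) * C.card) ≤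
      ∑ p ∈ Finset.range L ×ˢ (Finset.univ : Finset (Fin d → ZMod N)),
        ((B p.1 p.2).card : ℝ) := by
    have h1 : ∀ (l : ℕ) (x : Fin d → ZMod N), ((B l x).card : ℝ) =
        ∑ n ∈ Finset.range M, if good l n ∧ x + col l n ∈ C then (1 : ℝ) else 0 := by
      intro l x
      rw [Finset.sum_boole]
    have h2 : ∀ l n, ∑ x : Fin d → ZMod N,
        (if good l n ∧ x + col l n ∈ C then (1 : ℝ) else 0) =
        if good l n then (C.card : ℝ) else 0 := by
      intro l n
      by_cases hg : good l n
      · simp only [hg, true_and, if_true]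
        exact (Equiv.sum_comp (Equiv.addRight (col l n))
          (fun y => if y ∈ C then (1 : ℝ) else 0)).trans (by simp)
      · simp [hg]
    rw [Finset.sum_product]
    simp only [h1]
    simp_rw [Finset.sum_comm (s := (Finset.univ : Finset (Fin d → ZMod N))), h2]
    rw [Finset.sum_comm]
    calc (M : ℝ) * ((L - d) * C.card) = ∑ _n ∈ Finset.range M, ((L : ℝ) - d) * C.card := by simp
      _ ≤ _ := Finset.sum_le_sum fun n _ => by
          rw [← Finset.sum_filter, Finset.sum_const, nsmul_eq_mul]
          exact mul_le_mul_of_nonneg_right (hgood n) (Nat.cast_nonneg _)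
  obtain ⟨⟨l, x⟩, -, hB⟩ : ∃ p ∈ Finset.range L ×ˢ (Finset.univ : Finset (Fin d → ZMod N)),
      θ * M ≤ (B p.1 p.2).card := by
    apply Finset.exists_le_of_sum_le
    · refine Finset.Nonempty.product ?_ Finset.univ_nonempty
      rw [Finset.nonempty_range_iff]
      exact_mod_cast hL0.ne'
    · refine le_trans (le_of_eq ?_) hcount
      rw [Finset.sum_const, Finset.card_product, Finset.card_range, Finset.card_univ,
        Fintype.card_fun, ZMod.card, Fintype.card_fin, nsmul_eq_mul]
      have : θ * (L * (N : ℝ) ^ d) = (L - d) * C.card := div_mul_cancel₀ _ (by positivity)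
      push_cast
      linear_combination (M : ℝ) * this
  dsimp only at hB
  have : NeZero (M + R) := ⟨by omega⟩
  refine ⟨M + R, this, (B l x).image (Nat.cast : ℕ → ZMod (M + R)), ?_, ?_⟩
  · rw [Finset.card_image_of_injOn]
    · push_cast
      linarith
    · intro n hn n' hn' hnn
      have h1 : n < M := Finset.mem_range.1 (Finset.mem_filter.1 hn).1
      have h2 : n' < M := Finset.mem_range.1 (Finset.mem_filter.1 hn').1
      have h3 := (ZMod.natCast_eq_natCast_iff' _ _ _).1 hnn
      rwa [Nat.mod_eq_of_lt (by omega), Nat.mod_eq_of_lt (by omega)] at h3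
  · rintro f hf _ hn hn'
    obtain ⟨n, hnB, rfl⟩ := Finset.mem_image.1 hn
    obtain ⟨n', hnB', hnn⟩ := Finset.mem_image.1 hn'
    obtain ⟨hnM, hng, hnC⟩ := Finset.mem_filter.1 hnB
    obtain ⟨hnM', -, hnC'⟩ := Finset.mem_filter.1 hnB'
    rw [Finset.mem_range] at hnM hnM'
    have heq : (n' : ℤ) = n + f := by
      have h1 : (((n' : ℤ) - (n + f) : ℤ) : ZMod (M + R)) = 0 := by
        push_cast
        exact sub_eq_zero.2 hnn
      rw [ZMod.intCast_zmod_eq_zero_iff_dvd] at h1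
      have h2 := abs_le.1 (hR f hf)
      have := Int.eq_zero_of_abs_lt_dvd h1 (by
        push_cast
        rw [abs_lt]
        constructor <;> omega)
      omega
    obtain ⟨g, hg, hcard⟩ := hF f hf
    have hcol : ∀ i, ‖f • α i - (((g : ℝ) / N : ℝ) : UnitAddCircle)‖ < ρ / N →
        col l n' i = col l n i + g := by
      intro i hi
      rw [ha' i, ← AddCircle.coe_zsmul, ← AddCircle.coe_sub, UnitAddCircle.norm_eq,
        zsmul_eq_mul] at hi
      set z := round (f * a i - (g : ℝ) / N)
      have hδ : |N * (f * a i - (g : ℝ) / N - z)| < ρ := by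
        rw [abs_mul, abs_of_pos hN0, mul_comm]
        exact (lt_div_iff₀ hN0).1 hi
      have h1 : pos l n' i = pos l n i + ((g + N * z : ℤ) : ℝ) +
          N * (f * a i - (g : ℝ) / N - z) := by
        have : (n' : ℝ) = n + f := by exact_mod_cast heq
        simp only [pos]
        rw [this]
        push_cast
        field_simp
        ring
      simp only [col]
      rw [h1, floor_add_eq_of_fract _ (hng i).1 (hng i).2 hδ]
      push_cast
      simp
    have hle : ∀ w, letterCount (x + col l n) w ≤ letterCount (x + col l n') (w + g) + k ∧
        letterCount (x + col l n') (w + g) ≤ letterCount (x + col l n) w + k := by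
      intro w
      simp only [letterCount]
      constructor
      · refine (Finset.card_le_card (t := (Finset.univ.filter fun i =>
          (x + col l n') i = w + g) ∪ Finset.univ.filter fun i =>
          ρ / N ≤ ‖f • α i - (((g : ℝ) / N : ℝ) : UnitAddCircle)‖) ?_).trans
          ((Finset.card_union_le _ _).trans (Nat.add_le_add_left hcard _))
        intro i hi
        simp only [Finset.mem_filter, Finset.mem_union, Finset.mem_univ, true_and] at hi ⊢
        by_cases h1 : ρ / N ≤ ‖f • α i - (((g : ℝ) / N : ℝ) : UnitAddCircle)‖
        · exact Or.inr h1
        · left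
          rw [Pi.add_apply, hcol i (not_le.1 h1), ← add_assoc, ← hi, Pi.add_apply]
      · refine (Finset.card_le_card (t := (Finset.univ.filter fun i =>
          (x + col l n) i = w) ∪ Finset.univ.filter fun i =>
          ρ / N ≤ ‖f • α i - (((g : ℝ) / N : ℝ) : UnitAddCircle)‖) ?_).trans
          ((Finset.card_union_le _ _).trans (Nat.add_le_add_left hcard _))
        intro i hi
        simp only [Finset.mem_filter, Finset.mem_union, Finset.mem_univ, true_and] at hi ⊢
        by_cases h1 : ρ / N ≤ ‖f • α i - (((g : ℝ) / N : ℝ) : UnitAddCircle)‖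
        · exact Or.inr h1
        · left
          rw [Pi.add_apply, hcol i (not_le.1 h1), ← add_assoc] at hi
          exact add_right_cancel hi
    obtain ⟨v, hvA, hv⟩ := Finset.mem_biUnion.1 hnC
    obtain ⟨v', hvA', hv'⟩ := Finset.mem_biUnion.1 hnC'
    -- Each count changes by at most `k`, so the margin `2 * k` of `v` leaves a strict lead for `v +
    -- g`.
    have hlead : x + col l n' ∈ leadingWords d 0 (v + g) := by
      rw [mem_leadingWords] at hv ⊢
      intro w hw
      have h1 := hv (w - g) (fun h => hw (by rw [← h]; ring))
      have h2 := (hle v).1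
      have h3 := (hle (w - g)).2
      rw [sub_add_cancel] at h3
      omega
    have := eq_of_mem_leadingWords hv' hlead
    exact hE g hg v hvA (this ▸ hvA')

/-! ### Bohr neighbourhoods -/

theorem isOpen_bohrTopology_setOf_norm_lt (γ y : UnitAddCircle) (ε : ℝ) :
    @IsOpen ℤ bohrTopology {n : ℤ | ‖n • γ - y‖ < ε} := by
  let χ : ℤ →+ UnitAddCircle := zmultiplesHom _ γ
  have h1 : @Continuous ℤ UnitAddCircle bohrTopology _ χ :=
    continuous_iInf_dom (i := χ) continuous_induced_dom
  have h2 : IsOpen {x : UnitAddCircle | ‖x - y‖ < ε} :=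
    isOpen_lt (continuous_id.sub continuous_const).norm continuous_const
  exact @IsOpen.preimage ℤ UnitAddCircle bohrTopology _ χ h1 _ h2

theorem IsBohrDense.exists_mem_zsmul_near {S : Set ℤ} (hS : IsBohrDense S) {ι : Type*} [Fintype ι]
    (γ y : ι → UnitAddCircle) {ε : ℝ} (h : ∃ n : ℤ, ∀ i, ‖n • γ i - y i‖ < ε) :
    ∃ s ∈ S, ∀ i, ‖s • γ i - y i‖ < ε := by
  have hopen : @IsOpen ℤ bohrTopology (⋂ i, {n : ℤ | ‖n • γ i - y i‖ < ε}) :=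
    @isOpen_iInter_of_finite ℤ ι bohrTopology _ _ fun i =>
      isOpen_bohrTopology_setOf_norm_lt (γ i) (y i) ε
  obtain ⟨n, hn⟩ := h
  obtain ⟨s, hs, hsS⟩ := @Dense.inter_open_nonempty ℤ bohrTopology S hS _ hopen
    ⟨n, Set.mem_iInter.2 hn⟩
  exact ⟨s, hsS, fun i => Set.mem_iInter.1 hs i⟩

/-- A homomorphism from `ℤ` is determined by its value at `1`, so finite sets of circle points
describe all basic neighbourhoods. -/
theorem isBohrDense_of_forall_finset {S : Set ℤ}
    (h : ∀ (t : Finset UnitAddCircle) (l : ℤ) (ε : ℝ), 0 < ε →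
      ∃ s ∈ S, ∀ β ∈ t, ‖s • β - l • β‖ < ε) : IsBohrDense S := by
  classical
  intro l
  rw [@mem_closure_iff_nhds ℤ bohrTopology]
  intro U hU
  rw [bohrTopology, nhds_iInf] at hU
  simp only [nhds_induced] at hU
  obtain ⟨I, hI, V, hV, -, rfl, -⟩ := Filter.mem_iInf'.1 hU
  have hε : ∀ᶠ ε : ℝ in nhdsWithin 0 (Set.Ioi 0), ∀ χ ∈ I,
      (χ : ℤ → UnitAddCircle) ⁻¹' Metric.ball (χ l) ε ⊆ V χ := by
    rw [Filter.eventually_all_finite hI]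
    intro χ _
    obtain ⟨W, hW, hWV⟩ := Filter.mem_comap.1 (hV χ)
    obtain ⟨δ, hδ, hball⟩ := Metric.mem_nhds_iff.1 hW
    filter_upwards [Ioo_mem_nhdsGT hδ] with ε hε
    exact (Set.preimage_mono ((Metric.ball_subset_ball hε.2.le).trans hball)).trans hWV
  obtain ⟨ε, hεI, hε0⟩ := (hε.and self_mem_nhdsWithin).exists
  obtain ⟨s, hsS, hs⟩ := h (hI.toFinset.image fun χ => χ 1) l ε hε0
  refine ⟨s, Set.mem_iInter₂.2 fun χ hχ => hεI χ hχ ?_, hsS⟩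
  have h1 := hs (χ 1) (Finset.mem_image_of_mem _ (hI.mem_toFinset.2 hχ))
  rw [← map_zsmul, ← map_zsmul, smul_eq_mul, mul_one, smul_eq_mul, mul_one] at h1
  rw [Set.mem_preimage, Metric.mem_ball, dist_eq_norm]
  exact h1

theorem exists_pos_le_forall {ι : Type*} [Finite ι] (ε : ι → ℝ) (hε : ∀ i, 0 < ε i) :
    ∃ δ : ℝ, 0 < δ ∧ ∀ i, δ ≤ ε i := by
  have h : ∀ᶠ δ : ℝ in nhdsWithin 0 (Set.Ioi 0), ∀ i, δ ≤ ε i :=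
    Filter.eventually_all.2 fun i => Filter.mem_of_superset (Ioo_mem_nhdsGT (hε i))
      fun _ hδ => hδ.2.le
  obtain ⟨δ, h1, h2⟩ := (h.and self_mem_nhdsWithin).exists
  exact ⟨δ, h2, h1⟩

/-- Prescribing the approximate value of `s • α i` for linearly independent `α i`, a Bohr dense set
meets every Bohr neighbourhood of rank `r` in points `s` which respect all but `r` of the
prescriptions. -/
theorem IsBohrDense.exists_near_and_card_le {S : Set ℤ} (hS : IsBohrDense S) {κ : Type*} [Fintype κ]
    (α y : κ → UnitAddCircle) (hα : LinearIndependent ℤ α) {r : ℕ} (β : Fin r → UnitAddCircle)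
    (l : ℤ) {ε : ℝ} (hε : 0 < ε) :
    ∃ s ∈ S, (∀ j, ‖s • β j - l • β j‖ < ε) ∧
      (Finset.univ.filter fun i => ε ≤ ‖s • α i - y i‖).card ≤ r := by
  classical
  obtain ⟨J, hJ, hind⟩ := exists_card_le_forall_eq_zero α hα r β
  let γ : Fin r ⊕ {i // i ∉ J} → UnitAddCircle := Sum.elim β fun i => α i
  let z : Fin r ⊕ {i // i ∉ J} → UnitAddCircle := Sum.elim (l • β) fun i => y i
  -- In a relation among the `γ i` the `α` part vanishes by independence. What remains is a relation
  -- among the `β j`, which persists after multiplication by `l`.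
  have hrel : ∀ b : Fin r ⊕ {i // i ∉ J} → ℤ, ∑ i, b i • γ i = 0 → ∑ i, b i • z i = 0 := by
    intro b hb
    rw [Fintype.sum_sum_type] at hb ⊢
    simp only [γ, z, Sum.elim_inl, Sum.elim_inr, Pi.smul_apply] at hb ⊢
    let b' : κ → ℤ := fun i => if h : i ∉ J then b (Sum.inr ⟨i, h⟩) else 0
    have hsum : ∑ i, b' i • α i = ∑ i : {i // i ∉ J}, b (Sum.inr i) • α i := by
      rw [← Finset.sum_subset (Finset.subset_univ (Finset.univ.filter fun i => i ∉ J))]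
      · rw [Finset.sum_subtype (Finset.univ.filter fun i => i ∉ J) (p := fun i => i ∉ J)
          (by simp)]
        refine Finset.sum_congr rfl fun i _ => ?_
        simp only [b', dif_pos i.2]
      · intro i _ hi
        have hiJ : ¬ i ∉ J := fun h => hi (by simp [h])
        simp only [b', dif_neg hiJ, zero_smul]
    have hb' : b' = 0 := by
      apply hind (fun j => b (Sum.inl j)) b'
      · intro i hi
        simp only [b', dif_neg (not_not.2 hi)]
      · rw [hsum, hb]
    have hinr : ∀ i : {i // i ∉ J}, b (Sum.inr i) = 0 := by
      intro i
      have := congrFun hb' i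
      simpa only [b', dif_pos i.2, Pi.zero_apply] using this
    simp only [hinr, zero_smul, Finset.sum_const_zero, add_zero] at hb ⊢
    simp only [smul_comm _ l]
    rw [← Finset.smul_sum, hb, smul_zero]
  obtain ⟨s, hsS, hs⟩ := hS.exists_mem_zsmul_near γ z (exists_zsmul_near γ z hrel hε)
  refine ⟨s, hsS, fun j => hs (Sum.inl j), (Finset.card_le_card fun i hi => ?_).trans hJ⟩
  by_contra hiJ
  exact absurd (Finset.mem_filter.1 hi).2 (not_le.2 (hs (Sum.inr ⟨i, hiJ⟩)))

/-! ### Construction of the subset -/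

/-- The inductive step: finitely many elements of a Bohr dense set meet all Bohr neighbourhoods
of given rank, radius and centres, and can be added to given finite sets, after translation,
without destroying the existence of avoiding sets. -/
theorem IsBohrDense.exists_finset_extension {S : Set ℤ} (hS : IsBohrDense S) (r : ℕ)
    (m : Fin r → ℤ) (E : Fin r → Finset ℤ) (c : Fin r → ℝ)
    (hE : ∀ i, HasAvoidingSet (c i) (E i)) (h1 : ∀ i, (1 : ℤ) ∈ E i) (Λ : Finset ℤ) {δ : ℝ}
    (hδ : 0 < δ) :
    ∃ G : Finset ℤ, (G : Set ℤ) ⊆ S ∧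
      (∀ β : Fin r → UnitAddCircle, ∀ l ∈ Λ, ∃ s ∈ G, ∀ j, ‖s • β j - l • β j‖ < δ) ∧
      ∀ i, HasAvoidingSet (c i) (E i ∪ G.image (· - m i) : Finset ℤ) := by
  classical
  choose N d ε hε hext using fun i => (hE i).exists_extension r
  let κ : Type := Σ i : Fin r, Fin (d i)
  -- One tolerance for all purposes; `none` carries `δ`.
  obtain ⟨ε₀, hε₀, hle⟩ := exists_pos_le_forall (Option.elim · δ ε)
    (by rintro (_ | i); exacts [hδ, hε i])
  let t : Fin r → UnitAddCircle := fun i => (((1 : ℤ) / N i : ℝ) : UnitAddCircle)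
  -- Perturb the points `1 / N i` to independent ones, so closely that the old elements `e ∈ E i`
  -- still act as `e` does on `ℤ/N i`.
  obtain ⟨α, hαO, hα⟩ := (dense_linearIndependent_int κ).inter_open_nonempty
    (⋂ i, ⋂ e : E i, ⋂ j : Fin (d i),
      {α | ‖(e : ℤ) • α ⟨i, j⟩ - (((e : ℤ) / N i : ℝ) : UnitAddCircle)‖ < ε i})
    (by
      refine isOpen_iInter_of_finite fun i => isOpen_iInter_of_finite fun e =>
        isOpen_iInter_of_finite fun j => isOpen_lt ?_ continuous_const
      exact (((continuous_apply _).zsmul _).sub continuous_const).norm)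
    ⟨fun p => t p.1, by
      simp only [Set.mem_iInter, Set.mem_ofPred_eq]
      intro i e j
      have : (e : ℤ) • t i = (((e : ℤ) / N i : ℝ) : UnitAddCircle) := by
        simp only [t]
        rw [← AddCircle.coe_zsmul, zsmul_eq_mul]
        congr 1
        push_cast
        ring
      rw [this, sub_self, norm_zero]
      exact hε i⟩
  simp only [Set.mem_iInter, Set.mem_ofPred_eq] at hαO
  -- With this target, `s • α ≈ y` says that `s - m i` acts approximately as `1` does on `ℤ/N i`.
  let y : κ → UnitAddCircle := fun p => t p.1 + m p.1 • α p
  let V : Set ℤ := {s | s ∈ S ∧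
    ∀ i, (Finset.univ.filter fun j => ε i ≤ ‖s • α ⟨i, j⟩ - y ⟨i, j⟩‖).card ≤ r}
  have hV : ∀ (β : Fin r → UnitAddCircle) (l : ℤ), ∃ s ∈ V, ∀ j, ‖s • β j - l • β j‖ < δ := by
    intro β l
    obtain ⟨s, hsS, hs, hcard⟩ := hS.exists_near_and_card_le α y hα β l hε₀
    refine ⟨s, ⟨hsS, fun i => ?_⟩, fun j => (hs j).trans_le (hle none)⟩
    refine le_trans (Finset.card_le_card_of_injOn (fun j => (⟨i, j⟩ : κ)) ?_ ?_) hcard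
    · intro j hj
      simp only [Finset.coe_filter, Finset.mem_univ, true_and, Set.mem_ofPred_eq] at hj ⊢
      exact (hle (some i)).trans hj
    · intro j _ j' _ hjj
      exact eq_of_heq (Sigma.mk.inj hjj).2
  have hcover : ∀ l : ℤ, ∃ G : Finset ℤ, (G : Set ℤ) ⊆ V ∧
      ∀ β : Fin r → UnitAddCircle, ∃ s ∈ G, ∀ j, ‖s • β j - l • β j‖ < δ := by
    intro l
    -- For fixed `s` and `l` the condition is open in `β`, and the torus of all `β` is compact.
    obtain ⟨b, hbV, hbfin, hb⟩ := (isCompact_univ (X := Fin r → UnitAddCircle)).elim_finite_subcover_image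
      (b := V) (c := fun s => ⋂ j, {β : Fin r → UnitAddCircle | ‖s • β j - l • β j‖ < δ})
      (fun s _ => isOpen_iInter_of_finite fun j => isOpen_lt
        (((continuous_apply j).zsmul s).sub ((continuous_apply j).zsmul l)).norm continuous_const)
      (fun β _ => by
        obtain ⟨s, hs, h⟩ := hV β l
        exact Set.mem_iUnion₂.2 ⟨s, hs, Set.mem_iInter.2 h⟩)
    refine ⟨hbfin.toFinset, by simpa using hbV, fun β => ?_⟩
    obtain ⟨s, hs, h⟩ := Set.mem_iUnion₂.1 (hb (Set.mem_univ β))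
    exact ⟨s, hbfin.mem_toFinset.2 hs, fun j => Set.mem_iInter.1 h j⟩
  choose G hGV hG using hcover
  refine ⟨Λ.biUnion G, ?_, ?_, ?_⟩
  · intro s hs
    obtain ⟨l, -, hl⟩ := Finset.mem_biUnion.1 (Finset.mem_coe.1 hs)
    exact (hGV l hl).1
  · intro β l hl
    obtain ⟨s, hs, h⟩ := hG l β
    exact ⟨s, Finset.mem_biUnion.2 ⟨l, hl, hs⟩, h⟩
  · intro i
    refine hext i (fun j => α ⟨i, j⟩) _ fun f hf => ?_
    rcases Finset.mem_union.1 hf with hf | hf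
    · refine ⟨f, hf, ?_⟩
      rw [Finset.card_eq_zero.2]
      · exact Nat.zero_le r
      · rw [Finset.filter_eq_empty_iff]
        intro j _
        exact not_le.2 (hαO i ⟨f, hf⟩ j)
    · obtain ⟨s, hs, rfl⟩ := Finset.mem_image.1 hf
      obtain ⟨l, -, hl⟩ := Finset.mem_biUnion.1 hs
      -- New elements imitate `1`, which is why `1` must belong to every `E i`.
      refine ⟨1, h1 i, le_trans (le_of_eq ?_) ((hGV l hl).2 i)⟩
      congr 1
      refine Finset.filter_congr fun j _ => ?_
      have : (s - m i) • α ⟨i, j⟩ - (((1 : ℤ) / N i : ℝ) : UnitAddCircle) =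
          s • α ⟨i, j⟩ - y ⟨i, j⟩ := by
        simp only [y, t]
        rw [sub_smul]
        abel
      rw [this]

/-- Every Bohr dense set has a Bohr dense subset `S'` such that, for every `m`, the finite subsets
of `(S' - m) \ {0}` have avoiding sets of density bounded from below. -/
theorem IsBohrDense.exists_subset_hasAvoidingSet {S : Set ℤ} (hS : IsBohrDense S) :
    ∃ S' ⊆ S, IsBohrDense S' ∧ ∀ m : ℤ, ∃ c : ℝ, 0 < c ∧ ∀ F : Finset ℤ,
      (F : Set ℤ) ⊆ ((fun s : ℤ => s - m) '' S') \ {0} → HasAvoidingSet c F := by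
  classical
  obtain ⟨e, he⟩ := exists_surjective_nat ℤ
  let E : Finset ℤ → ℕ → Finset ℤ := fun P i => insert 1 ((P.image (· - e i)).erase 0)
  let valid : ℕ → Finset ℤ × (ℕ → ℝ) → Prop := fun r p => (p.1 : Set ℤ) ⊆ S ∧
    ∀ i < r, 0 < p.2 i ∧ HasAvoidingSet (p.2 i) (E p.1 i)
  let rel : ℕ → Finset ℤ × (ℕ → ℝ) → Finset ℤ × (ℕ → ℝ) → Prop := fun r p q =>
    p.1 ⊆ q.1 ∧ (∀ i < r, q.2 i = p.2 i) ∧ ∀ β : Fin r → UnitAddCircle, ∀ i < r,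
      ∃ s ∈ q.1, ∀ j, ‖s • β j - e i • β j‖ < 1 / ((r : ℝ) + 1)
  have step : ∀ r p, valid r p → ∃ q, valid (r + 1) q ∧ rel r p q := by
    rintro r ⟨P, c⟩ ⟨hPS, hc⟩
    obtain ⟨G, hGS, hG, hGE⟩ := hS.exists_finset_extension r (fun i => e i) (fun i => E P i)
      (fun i => c i) (fun i => (hc i i.2).2) (fun i => Finset.mem_insert_self _ _)
      ((Finset.range r).image e) (δ := 1 / ((r : ℝ) + 1)) (by positivity)
    -- The new index `r` starts with whatever density its finite set allows; the constants of
    -- earlier indices are kept.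
    obtain ⟨c', hc'0, hc'⟩ := exists_hasAvoidingSet_of_zero_notMem (E (P ∪ G) r) (by simp [E])
    refine ⟨(P ∪ G, Function.update c r c'), ⟨?_, fun i hi => ?_⟩, ?_, fun i hi => ?_, ?_⟩
    · rw [Finset.coe_union]
      exact Set.union_subset hPS hGS
    · dsimp only
      rcases Nat.lt_succ_iff_lt_or_eq.1 hi with hi | rfl
      · rw [Function.update_of_ne hi.ne]
        refine ⟨(hc i hi).1, (hGE ⟨i, hi⟩).mono ?_⟩
        rw [Finset.coe_subset]
        intro x hx
        simp only [E, Finset.mem_insert, Finset.mem_erase, Finset.mem_union,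
          Finset.mem_image] at hx ⊢
        rcases hx with rfl | ⟨hx0, s, hs | hs, rfl⟩
        · exact Or.inl (Or.inl rfl)
        · exact Or.inl (Or.inr ⟨hx0, s, hs, rfl⟩)
        · exact Or.inr ⟨s, hs, rfl⟩
      · rw [Function.update_self]
        exact ⟨hc'0, hc'⟩
    · exact Finset.subset_union_left
    · exact Function.update_of_ne hi.ne _ _
    · intro β i hi
      obtain ⟨s, hs, h⟩ := hG β (e i) (Finset.mem_image_of_mem e (Finset.mem_range.2 hi))
      exact ⟨s, Finset.mem_union_right _ hs, h⟩
  choose! next hnext using step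
  let p : ℕ → Finset ℤ × (ℕ → ℝ) := fun r => Nat.rec (∅, fun _ => 0) (fun r q => next r q) r
  have hvalid : ∀ r, valid r (p r) := by
    intro r
    induction r with
    | zero => exact ⟨by simp [p], fun i hi => absurd hi (Nat.not_lt_zero i)⟩
    | succ r ih => exact (hnext r (p r) ih).1
  have hrel : ∀ r, rel r (p r) (p (r + 1)) := fun r => (hnext r (p r) (hvalid r)).2
  have hmono : Monotone fun r => (p r).1 := monotone_nat_of_le_succ fun r => (hrel r).1
  have hconst : ∀ i r, i + 1 ≤ r → (p r).2 i = (p (i + 1)).2 i := by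
    intro i r hr
    induction r, hr using Nat.le_induction with
    | base => rfl
    | succ r hr ih => rw [(hrel r).2.1 i hr, ih]
  refine ⟨⋃ r, ((p r).1 : Set ℤ), Set.iUnion_subset fun r => (hvalid r).1,
    isBohrDense_of_forall_finset fun t l ε hε => ?_, fun m => ?_⟩
  · obtain ⟨i, rfl⟩ := he l
    obtain ⟨n, hn⟩ := exists_nat_one_div_lt hε
    set r := max (i + 1) (max n t.card)
    have hr1 : i < r := Nat.lt_of_succ_le (le_max_left _ _)
    have hr2 : n ≤ r := (le_max_left _ _).trans (le_max_right _ _)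
    have hr3 : t.card ≤ r := (le_max_right _ _).trans (le_max_right _ _)
    -- List the frequencies in `t` and pad with zeros up to rank `r`.
    obtain ⟨s, hs, h⟩ := (hrel r).2.2
      (fun j => if hj : (j : ℕ) < t.card then t.equivFin.symm ⟨j, hj⟩ else 0) i hr1
    refine ⟨s, Set.mem_iUnion.2 ⟨r + 1, hs⟩, fun β hβ => ?_⟩
    have h1 := h ⟨t.equivFin ⟨β, hβ⟩, (t.equivFin ⟨β, hβ⟩).2.trans_le hr3⟩
    rw [dif_pos (t.equivFin ⟨β, hβ⟩).2] at h1
    simp only [Fin.eta, Equiv.symm_apply_apply] at h1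
    refine h1.trans (lt_of_le_of_lt ?_ hn)
    gcongr
  · obtain ⟨i, rfl⟩ := he m
    refine ⟨(p (i + 1)).2 i, ((hvalid (i + 1)).2 i (Nat.lt_succ_self i)).1, fun F hF => ?_⟩
    obtain ⟨r, hr⟩ : ∃ r, ∀ f ∈ F, f + e i ∈ (p r).1 := by
      have h1 : ∀ f : F, ∃ r, (f : ℤ) + e i ∈ (p r).1 := by
        intro f
        obtain ⟨⟨s, hs, hsf⟩, -⟩ := hF f.2
        obtain ⟨r, hr⟩ := Set.mem_iUnion.1 hs
        refine ⟨r, ?_⟩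
        dsimp only at hsf
        rw [← hsf, sub_add_cancel]
        exact hr
      choose ρ hρ using h1
      refine ⟨Finset.univ.sup ρ, fun f hf => hmono ?_ (hρ ⟨f, hf⟩)⟩
      exact Finset.le_sup (f := ρ) (Finset.mem_univ _)
    have hle : i + 1 ≤ max r (i + 1) := le_max_right _ _
    have h2 := ((hvalid (max r (i + 1))).2 i hle).2
    rw [hconst i _ hle] at h2
    refine h2.mono fun f hf => ?_
    have h3 := hmono (le_max_left r (i + 1)) (hr f hf)
    have h4 : f ≠ 0 := (hF hf).2
    simp only [E, Finset.coe_insert, Finset.coe_erase, Finset.coe_image]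
    exact Or.inr ⟨⟨f + e i, h3, by ring⟩, h4⟩

/-! ### Correspondence principle -/

/-- The shift on two-sided binary sequences. -/
def binaryShift : (ℤ → Bool) ≃ᵐ (ℤ → Bool) where
  toFun ω k := ω (k + 1)
  invFun ω k := ω (k - 1)
  left_inv ω := by funext k; simp
  right_inv ω := by funext k; simp
  measurable_toFun := measurable_pi_lambda _ fun _ => measurable_pi_apply _
  measurable_invFun := measurable_pi_lambda _ fun _ => measurable_pi_apply _

theorem binaryShift_zpow_apply (n : ℤ) (ω : ℤ → Bool) (k : ℤ) :
    ((binaryShift.toEquiv : Equiv.Perm (ℤ → Bool)) ^ n) ω k = ω (k + n) := by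
  have h1 : ∀ ω' k, (binaryShift.toEquiv : Equiv.Perm (ℤ → Bool)) ω' k = ω' (k + 1) :=
    fun _ _ => rfl
  have h2 : ∀ ω' k, (binaryShift.toEquiv : Equiv.Perm (ℤ → Bool))⁻¹ ω' k = ω' (k - 1) :=
    fun _ _ => rfl
  induction n using Int.induction_on generalizing ω k with
  | zero => simp
  | succ n ih =>
    rw [zpow_add_one, Equiv.Perm.mul_apply, ih, h1]
    congr 1
    ring
  | pred n ih =>
    rw [zpow_sub_one, Equiv.Perm.mul_apply, ih, h2]
    congr 1
    ring

theorem continuous_binaryShift : Continuous binaryShift :=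
  continuous_pi fun _ => continuous_apply _

open MeasureTheory in
/-- An avoiding set in a cyclic group, seen as a shift-invariant measure on binary sequences. -/
theorem HasAvoidingSet.exists_probabilityMeasure {c : ℝ} {E : Set ℤ} (h : HasAvoidingSet c E) :
    ∃ μ : ProbabilityMeasure (ℤ → Bool),
      μ.map (binaryShift.measurable.aemeasurable) = μ ∧
      ENNReal.ofReal c ≤ (μ : Measure (ℤ → Bool)) {ω | ω 0 = true} ∧
      ∀ e ∈ E, (μ : Measure (ℤ → Bool)) {ω | ω 0 = true ∧ ω (-e) = true} = 0 := by
  classical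
  obtain ⟨N, hN, A, hA, hE⟩ := h
  let mN : MeasurableSpace (ZMod N) := ⊤
  have hN0 : (0 : ℝ) < N := by exact_mod_cast Nat.pos_of_ne_zero hN.ne
  let ν : Measure (ZMod N) := (N : ENNReal)⁻¹ • Measure.count
  have hν : ∀ s : Set (ZMod N), ν s = (N : ENNReal)⁻¹ * (s.encard : ENNReal) := by
    intro s
    rw [Measure.smul_apply, Measure.count_apply MeasurableSpace.measurableSet_top, smul_eq_mul]
  have hνprob : IsProbabilityMeasure ν := ⟨by
    rw [hν, Set.encard_univ, ENat.card_eq_coe_fintype_card, ZMod.card]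
    exact ENNReal.inv_mul_cancel (by exact_mod_cast hN.ne) (ENNReal.natCast_ne_top N)⟩
  -- Each point is sent to its itinerary through `A`; `μ` is the image of the uniform measure.
  let φ : ZMod N → ℤ → Bool := fun a n => decide (a + (n : ZMod N) ∈ A)
  have hφ : Measurable φ := fun _ _ => trivial
  let μ : ProbabilityMeasure (ℤ → Bool) :=
    ⟨ν.map φ, Measure.isProbabilityMeasure_map hφ.aemeasurable⟩
  have hμ : ∀ s : Set (ℤ → Bool), MeasurableSet s →
      (μ : Measure (ℤ → Bool)) s = ν (φ ⁻¹' s) := fun s hs => Measure.map_apply hφ hs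
  have hD : ∀ n : ℤ, MeasurableSet {ω : ℤ → Bool | ω n = true} := fun n =>
    measurableSet_eq_fun (measurable_pi_apply n) measurable_const
  refine ⟨μ, ?_, ?_, fun e he => ?_⟩
  · suffices hmap : (μ.map binaryShift.measurable.aemeasurable : Measure (ℤ → Bool)) = μ from
      Subtype.ext hmap
    refine Measure.ext fun s hs => ?_
    rw [ProbabilityMeasure.toMeasure_map, Measure.map_apply binaryShift.measurable hs,
      hμ _ (binaryShift.measurable hs), hμ _ hs, hν, hν]
    have hpre : φ ⁻¹' (binaryShift ⁻¹' s) = (Equiv.addRight (1 : ZMod N)) ⁻¹' (φ ⁻¹' s) := by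
      ext a
      have : binaryShift (φ a) = φ (a + 1) := by
        funext k
        change decide (a + ((k + 1 : ℤ) : ZMod N) ∈ A) = decide (a + 1 + (k : ZMod N) ∈ A)
        push_cast
        rw [add_comm (k : ZMod N) 1, add_assoc]
      simp only [Set.mem_preimage, this, Equiv.coe_addRight]
    rw [hpre, Set.encard_preimage_of_bijective (Equiv.bijective _)]
  · rw [hμ _ (hD 0), hν]
    have hpre : φ ⁻¹' {ω : ℤ → Bool | ω 0 = true} = (A : Set (ZMod N)) := by
      ext a
      simp [φ]
    rw [hpre, Set.encard_coe_eq_coe_finsetCard, mul_comm]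
    have h1 : c ≤ A.card / N := by
      rw [le_div_iff₀ hN0]
      exact hA.le
    refine (ENNReal.ofReal_le_ofReal h1).trans (le_of_eq ?_)
    rw [ENNReal.ofReal_div_of_pos hN0, ENNReal.ofReal_natCast, ENNReal.ofReal_natCast,
      div_eq_mul_inv]
    rfl
  · rw [show {ω : ℤ → Bool | ω 0 = true ∧ ω (-e) = true} =
      {ω | ω 0 = true} ∩ {ω | ω (-e) = true} from rfl, hμ _ ((hD 0).inter (hD _)), hν]
    have hpre : φ ⁻¹' ({ω : ℤ → Bool | ω 0 = true} ∩ {ω | ω (-e) = true}) = ∅ := by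
      rw [Set.eq_empty_iff_forall_notMem]
      rintro a ⟨h1, h2⟩
      simp only [Set.mem_ofPred_eq, φ, decide_eq_true_eq, Int.cast_zero, add_zero,
        Int.cast_neg] at h1 h2
      have := hE e he _ h2
      rw [neg_add_cancel_right] at this
      exact this h1
    rw [hpre]
    simp

open MeasureTheory Filter Topology in
/-- A form of Furstenberg's correspondence principle: if the finite subsets of `E` have avoiding
sets of density bounded from below, then `E` is not a set of measurable recurrence. -/
theorem not_isMeasurableRecurrence_of_hasAvoidingSet {c : ℝ} (hc : 0 < c) {E : Set ℤ}
    (h : ∀ F : Finset ℤ, (F : Set ℤ) ⊆ E → HasAvoidingSet c F) : ¬ IsMeasurableRecurrence E := by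
  classical
  have hF : ∀ F : Finset E, ∃ μ : ProbabilityMeasure (ℤ → Bool),
      μ.map (binaryShift.measurable.aemeasurable) = μ ∧
      ENNReal.ofReal c ≤ (μ : Measure (ℤ → Bool)) {ω | ω 0 = true} ∧
      ∀ e ∈ F, (μ : Measure (ℤ → Bool)) {ω | ω 0 = true ∧ ω (-(e : ℤ)) = true} = 0 := by
    intro F
    obtain ⟨μ, h1, h2, h3⟩ := (h (F.image Subtype.val) (by
      intro x hx
      obtain ⟨y, -, rfl⟩ := Finset.mem_image.1 (Finset.mem_coe.1 hx)
      exact y.2)).exists_probabilityMeasure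
    exact ⟨μ, h1, h2, fun e he => h3 e (Finset.mem_coe.2 (Finset.mem_image_of_mem _ he))⟩
  choose u hu1 hu2 hu3 using hF
  -- The limit exists since the probability measures on a compact space form a compact space.
  -- Cylinders are clopen, so their measures pass to the limit.
  let 𝒰 : Ultrafilter (Finset E) := Ultrafilter.of atTop
  have h𝒰 : (𝒰 : Filter (Finset E)) ≤ atTop := Ultrafilter.of_le _
  let μ : ProbabilityMeasure (ℤ → Bool) := (𝒰.map u).lim
  have hlim : Tendsto u 𝒰 (𝓝 μ) := (𝒰.map u).le_nhds_lim
  have hclopen : ∀ s : Set (ℤ → Bool), IsClopen s →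
      Tendsto (fun F => (u F : Measure (ℤ → Bool)) s) 𝒰 (𝓝 ((μ : Measure (ℤ → Bool)) s)) := by
    intro s hs
    apply ProbabilityMeasure.tendsto_measure_of_null_frontier_of_tendsto' hlim
    rw [hs.frontier_eq, measure_empty]
  have hD : ∀ n : ℤ, IsClopen {ω : ℤ → Bool | ω n = true} := fun n =>
    (isClopen_discrete {true}).preimage (continuous_apply n)
  have hinv : μ.map (binaryShift.measurable.aemeasurable) = μ := by
    have h1 := ((ProbabilityMeasure.continuous_map continuous_binaryShift).tendsto μ).comp hlim
    refine tendsto_nhds_unique (h1.congr fun F => ?_) hlim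
    exact hu1 F
  have hpos : ENNReal.ofReal c ≤ (μ : Measure (ℤ → Bool)) {ω | ω 0 = true} :=
    ge_of_tendsto (hclopen _ (hD 0)) (Eventually.of_forall hu2)
  have hnull : ∀ e : E, (μ : Measure (ℤ → Bool)) {ω | ω 0 = true ∧ ω (-(e : ℤ)) = true} = 0 := by
    intro e
    refine tendsto_nhds_unique (hclopen _ ((hD 0).inter (hD _))) ?_
    refine tendsto_const_nhds.congr' ?_
    have h1 : ∀ᶠ F : Finset E in atTop, e ∈ F := by
      filter_upwards [eventually_ge_atTop {e}] with F hF
      exact hF (Finset.mem_singleton_self e)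
    filter_upwards [h𝒰 h1] with F hF
    exact (hu3 F e hF).symm
  intro hrec
  have hpres : MeasurePreserving binaryShift (μ : Measure (ℤ → Bool)) μ := by
    refine ⟨binaryShift.measurable, ?_⟩
    conv_rhs => rw [← hinv]
    rw [ProbabilityMeasure.toMeasure_map]
  -- The intersections are only null; removing `Z` from the set makes them empty.
  let Z : Set (ℤ → Bool) := ⋃ e : E, {ω | ω 0 = true ∧ ω (-(e : ℤ)) = true}
  have hZ : (μ : Measure (ℤ → Bool)) Z = 0 := measure_iUnion_null hnull
  have hZm : MeasurableSet Z := MeasurableSet.iUnion fun e =>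
    ((hD 0).inter (hD _)).isOpen.measurableSet
  obtain ⟨n, hn, ω, hω, ω', hω', rfl⟩ := hrec (ℤ → Bool) (μ : Measure (ℤ → Bool)) binaryShift hpres
    ({ω | ω 0 = true} \ Z) ((hD 0).isOpen.measurableSet.diff hZm) (by
      rw [measure_sdiff_null hZ]
      exact (ENNReal.ofReal_pos.2 hc).trans_le hpos)
  refine hω.2 (Set.mem_iUnion.2 ⟨⟨n, hn⟩, hω.1, ?_⟩)
  rw [binaryShift_zpow_apply, neg_add_cancel]
  exact hω'.1

/-! ### Upper Banach density and visit times -/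

theorem ncard_inter_Icc_le (A : Set ℤ) (k : ℤ) (n : ℕ) :
    (A ∩ Set.Icc (k + 1) (k + (n : ℤ))).ncard ≤ n := by
  refine (Set.ncard_le_ncard Set.inter_subset_right (Set.finite_Icc _ _)).trans ?_
  rw [← Finset.coe_Icc, Set.ncard_coe_finset, Int.card_Icc]
  omega

theorem ncard_inter_Icc_div_le_one (A : Set ℤ) (k : ℤ) (n : ℕ) :
    ((A ∩ Set.Icc (k + 1) (k + (n : ℤ))).ncard : ℝ) / (n : ℝ) ≤ 1 :=
  div_le_one_of_le₀ (by exact_mod_cast ncard_inter_Icc_le A k n) (Nat.cast_nonneg n)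

theorem bddAbove_ncard_inter_Icc_div (A : Set ℤ) (n : ℕ) :
    BddAbove (Set.range fun k : ℤ =>
      ((A ∩ Set.Icc (k + 1) (k + (n : ℤ))).ncard : ℝ) / (n : ℝ)) :=
  ⟨1, by rintro _ ⟨k, rfl⟩; exact ncard_inter_Icc_div_le_one A k n⟩

open Filter in
theorem upperBanachDensity_pos_of_frequently {A : Set ℤ} {δ : ℝ} (hδ : 0 < δ)
    (h : ∃ᶠ n : ℕ in atTop, ∃ k : ℤ,
      δ ≤ ((A ∩ Set.Icc (k + 1) (k + (n : ℤ))).ncard : ℝ) / (n : ℝ)) :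
    0 < upperBanachDensity A := by
  refine hδ.trans_le (le_limsup_of_frequently_le ?_ ?_)
  · refine h.mono fun n => ?_
    rintro ⟨k, hk⟩
    exact hk.trans (le_ciSup (bddAbove_ncard_inter_Icc_div A n) k)
  · exact isBoundedUnder_of ⟨1, fun n => ciSup_le fun k => ncard_inter_Icc_div_le_one A k n⟩

open Filter in
theorem frequently_of_lt_upperBanachDensity {A : Set ℤ} {δ : ℝ} (h : δ < upperBanachDensity A) :
    ∃ᶠ n : ℕ in atTop, ∃ k : ℤ,
      δ < ((A ∩ Set.Icc (k + 1) (k + (n : ℤ))).ncard : ℝ) / (n : ℝ) := by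
  refine (frequently_lt_of_lt_limsup ?_ h).mono fun n hn => exists_lt_of_lt_ciSup hn
  refine IsCoboundedUnder.of_frequently_ge (a := 0) (Frequently.of_forall fun n => ?_)
  exact Real.iSup_nonneg fun k => by positivity

open MeasureTheory Filter in
/-- In a probability measure preserving system, some point visits a given set of positive measure
along a set of times of positive upper Banach density. -/
theorem exists_upperBanachDensity_visits_pos {X : Type*} [MeasurableSpace X] (μ : Measure X)
    [IsProbabilityMeasure μ] (T : X ≃ᵐ X) (hT : MeasurePreserving T μ μ) {D : Set X}
    (hD : MeasurableSet D) (hμD : 0 < μ D) :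
    ∃ x, 0 < upperBanachDensity {n : ℤ | ((T.toEquiv : Equiv.Perm X) ^ n) x ∈ D} := by
  classical
  -- Times run from `1` to `N`, matching the window with `k = 0` in the density.
  let f : ℕ → X → ENNReal := fun N x =>
    (∑ i ∈ Finset.Icc 1 N, D.indicator 1 (T^[i] x)) / (N : ENNReal)
  have hmeas : ∀ i : ℕ, Measurable fun x => D.indicator (1 : X → ENNReal) (T^[i] x) := fun i =>
    (measurable_one.indicator hD).comp (T.measurable.iterate i)
  have hf : ∀ N, Measurable (f N) := fun N =>
    (Finset.measurable_sum _ fun i _ => hmeas i).div_const _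
  have hf1 : ∀ N x, f N x ≤ 1 := by
    intro N x
    refine ENNReal.div_le_of_le_mul ?_
    rw [one_mul]
    calc _ ≤ ∑ i ∈ Finset.Icc 1 N, (1 : ENNReal) := Finset.sum_le_sum fun i _ => by
          rw [Set.indicator_apply]
          split_ifs <;> simp
      _ = N := by simp
  have hint : ∀ N : ℕ, 0 < N → ∫⁻ x, f N x ∂μ = μ D := by
    intro N hN
    simp only [f, div_eq_mul_inv]
    rw [lintegral_mul_const _ (Finset.measurable_sum _ fun i _ => hmeas i),
      lintegral_finsetSum _ fun i _ => hmeas i]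
    have h1 : ∀ i : ℕ, ∫⁻ x, D.indicator (1 : X → ENNReal) (T^[i] x) ∂μ = μ D := by
      intro i
      rw [(hT.iterate i).lintegral_comp (measurable_one.indicator hD), lintegral_indicator_one hD]
    simp only [h1]
    rw [Finset.sum_const, Nat.card_Icc, Nat.add_sub_cancel, nsmul_eq_mul, mul_comm, ← mul_assoc,
      ENNReal.inv_mul_cancel (by exact_mod_cast hN.ne') (ENNReal.natCast_ne_top N), one_mul]
  have hlim : μ D ≤ ∫⁻ x, limsup (fun N => f N x) atTop ∂μ := by
    -- Reverse Fatou, with the constant `1` as dominating function.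
    have h1 := limsup_lintegral_le (μ := μ) (f := f) 1 hf
      (fun N => Eventually.of_forall fun x => hf1 N x) (by simp)
    refine le_trans (le_of_eq ?_) h1
    have h2 : (fun N => ∫⁻ x, f N x ∂μ) =ᶠ[atTop] fun _ => μ D := by
      filter_upwards [eventually_gt_atTop 0] with N hN using hint N hN
    rw [limsup_congr h2, limsup_const]
  obtain ⟨x, hx⟩ : ∃ x, 0 < limsup (fun N => f N x) atTop := by
    by_contra! hcon
    have : ∫⁻ x, limsup (fun N => f N x) atTop ∂μ = 0 := by
      rw [lintegral_congr fun x => nonpos_iff_eq_zero.1 (hcon x), lintegral_zero]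
    rw [this] at hlim
    exact absurd hμD (not_lt.2 hlim)
  obtain ⟨δ, hδ0, hδ⟩ := ENNReal.lt_iff_exists_nnreal_btwn.1 hx
  refine ⟨x, upperBanachDensity_pos_of_frequently (δ := δ) (by exact_mod_cast hδ0) ?_⟩
  refine ((frequently_lt_of_lt_limsup (by isBoundedDefault) hδ).and_eventually
    (eventually_gt_atTop 0)).mono ?_
  rintro N ⟨hN, hN0⟩
  refine ⟨0, ?_⟩
  have hset : {n : ℤ | ((T.toEquiv : Equiv.Perm X) ^ n) x ∈ D} ∩ Set.Icc (0 + 1) (0 + (N : ℤ)) =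
      (((Finset.Icc 1 N).filter fun i => T^[i] x ∈ D).image (Nat.cast : ℕ → ℤ) : Finset ℤ) := by
    have hit : ∀ i : ℕ, ((T.toEquiv : Equiv.Perm X) ^ (i : ℤ)) x = T^[i] x := by
      intro i
      rw [zpow_natCast, ← Equiv.Perm.iterate_eq_pow]
      rfl
    ext n
    simp only [Set.mem_inter_iff, Set.mem_ofPred_eq, Set.mem_Icc, zero_add, Finset.coe_image,
      Set.mem_image, Finset.mem_coe, Finset.mem_filter, Finset.mem_Icc]
    constructor
    · rintro ⟨h1, h2, h3⟩
      obtain ⟨i, rfl⟩ := Int.eq_ofNat_of_zero_le (by omega : 0 ≤ n)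
      rw [hit] at h1
      exact ⟨i, ⟨⟨by omega, by omega⟩, h1⟩, rfl⟩
    · rintro ⟨i, ⟨⟨h1, h2⟩, h3⟩, rfl⟩
      rw [hit]
      exact ⟨h3, by omega, by omega⟩
  rw [hset, Set.ncard_coe_finset, Finset.card_image_of_injective _ Nat.cast_injective]
  have hfN : f N x = (((Finset.Icc 1 N).filter fun i => T^[i] x ∈ D).card : ENNReal) / N := by
    simp only [f, Set.indicator_apply, Pi.one_apply]
    rw [Finset.sum_boole]
  rw [hfN, ENNReal.lt_div_iff_mul_lt (Or.inl (by exact_mod_cast hN0.ne'))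
    (Or.inl (ENNReal.natCast_ne_top N))] at hN
  rw [le_div_iff₀ (by exact_mod_cast hN0)]
  exact_mod_cast hN.le

/-- Take `A` to be the visit times of a point `x` to `D`. If `e = n - n'` with both times in `A`,
then `T ^ n x` lies in `D ∩ T ^ e D`. -/
theorem exists_disjoint_sub_of_not_isMeasurableRecurrence {E : Set ℤ}
    (hE : ¬ IsMeasurableRecurrence E) :
    ∃ A : Set ℤ, 0 < upperBanachDensity A ∧ ∀ e ∈ E, e ∉ A - A := by
  simp only [IsMeasurableRecurrence, not_forall] at hE
  obtain ⟨X, mX, μ, hμ, T, hT, D, hD, hμD, hE⟩ := hE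
  obtain ⟨x, hx⟩ := exists_upperBanachDensity_visits_pos μ T hT hD hμD
  refine ⟨_, hx, ?_⟩
  rintro e he ⟨n, hn, n', hn', rfl⟩
  refine hE ⟨_, he, _, hn, _, hn', ?_⟩
  rw [← Equiv.Perm.mul_apply, ← zpow_add, sub_add_cancel]

/-! ### The difference set topology -/

/-- Every finite set of integers has a subset of proportional size with all differences in `V`. -/
def HasLargeDifferenceSubsets (V : Set ℤ) : Prop :=
  ∃ η : ℝ, 0 < η ∧ ∀ F : Finset ℤ, ∃ G ⊆ F, η * F.card ≤ G.card ∧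
    ∀ a ∈ G, ∀ b ∈ G, a - b ∈ V

/-- Apply the second property to the subset given by the first. This stability is what handles
finite intersections of difference sets. -/
theorem HasLargeDifferenceSubsets.inter {V W : Set ℤ} (hV : HasLargeDifferenceSubsets V)
    (hW : HasLargeDifferenceSubsets W) : HasLargeDifferenceSubsets (V ∩ W) := by
  obtain ⟨η, hη, hV⟩ := hV
  obtain ⟨η', hη', hW⟩ := hW
  refine ⟨η' * η, mul_pos hη' hη, fun F => ?_⟩
  obtain ⟨G, hGF, hG, hGV⟩ := hV F
  obtain ⟨H, hHG, hH, hHW⟩ := hW G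
  refine ⟨H, hHG.trans hGF, ?_, fun a ha b hb => ⟨hGV a (hHG ha) b (hHG hb), hHW a ha b hb⟩⟩
  calc η' * η * F.card = η' * (η * F.card) := by ring
    _ ≤ η' * G.card := by gcongr
    _ ≤ H.card := hH

theorem HasLargeDifferenceSubsets.exists_ne_zero {V : Set ℤ} (hV : HasLargeDifferenceSubsets V) :
    ∃ e ∈ V, e ≠ 0 := by
  obtain ⟨η, hη, hV⟩ := hV
  obtain ⟨n, hn⟩ := exists_nat_gt (1 / η)
  obtain ⟨G, -, hG, hGV⟩ := hV ((Finset.range n).image (Nat.cast : ℕ → ℤ))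
  rw [Finset.card_image_of_injective _ Nat.cast_injective, Finset.card_range] at hG
  rw [div_lt_iff₀ hη] at hn
  have : (1 : ℝ) < G.card := by linarith
  obtain ⟨a, ha, b, hb, hab⟩ := Finset.one_lt_card.1 (by exact_mod_cast this)
  exact ⟨a - b, hGV a ha b hb, sub_ne_zero.2 hab⟩

/-- Averaging over `x` in a long window, some `x - F` meets `A` in a positive proportion of its
points. Differences of the corresponding elements of `F` are differences of elements of `A`. -/
theorem hasLargeDifferenceSubsets_sub_self {A : Set ℤ} (hA : 0 < upperBanachDensity A) :
    HasLargeDifferenceSubsets (A - A) := by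
  classical
  set δ := upperBanachDensity A / 2 with hδ
  have hδ0 : 0 < δ := by positivity
  refine ⟨δ / 2, by positivity, fun F => ?_⟩
  obtain ⟨R, hR⟩ : ∃ R : ℕ, ∀ f ∈ F, |f| ≤ R := by
    refine ⟨∑ f ∈ F, f.natAbs, fun f hf => ?_⟩
    have : f.natAbs ≤ ∑ f ∈ F, f.natAbs :=
      Finset.single_le_sum (f := fun f : ℤ => f.natAbs) (fun _ _ => Nat.zero_le _) hf
    rw [Int.abs_eq_natAbs]
    omega
  obtain ⟨n, ⟨k, hk⟩, hn⟩ := ((frequently_of_lt_upperBanachDensity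
    (show δ < upperBanachDensity A by rw [hδ]; linarith)).and_eventually
    (Filter.eventually_ge_atTop (2 * R + 1))).exists
  have hn0 : (0 : ℝ) < n := by exact_mod_cast (by omega : 0 < n)
  rw [lt_div_iff₀ hn0] at hk
  set B : Finset ℤ := (Finset.Icc (k + 1) (k + n)).filter (· ∈ A) with hB
  have hBcard : (A ∩ Set.Icc (k + 1) (k + (n : ℤ))).ncard = B.card := by
    rw [← Set.ncard_coe_finset]
    congr 1
    ext x
    simp only [hB, Finset.coe_filter, Finset.mem_Icc, Set.mem_inter_iff, Set.mem_Icc,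
      Set.mem_ofPred_eq]
    exact and_comm
  rw [hBcard] at hk
  -- Widening by `R` on both sides captures `b + f` for every `b ∈ B` and `f ∈ F`. It at most
  -- doubles the length, hence the constant `δ / 2`.
  let I : Finset ℤ := Finset.Icc (k + 1 - R) (k + n + R)
  have hI : (I.card : ℝ) ≤ 2 * n := by
    have : I.card ≤ 2 * n := by
      simp only [I, Int.card_Icc]
      omega
    exact_mod_cast this
  have hsum : ∑ x ∈ I, ((F.filter fun f => x - f ∈ B).card : ℝ) = F.card * B.card := by
    simp only [Finset.card_filter, Nat.cast_sum]
    rw [Finset.sum_comm]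
    have h1 : ∀ f ∈ F, ∑ x ∈ I, ((if x - f ∈ B then 1 else 0 : ℕ) : ℝ) = B.card := by
      intro f hf
      have hfR := abs_le.1 (hR f hf)
      rw [← Nat.cast_sum, ← Finset.card_filter]
      congr 1
      refine Finset.card_bij' (fun x _ => x - f) (fun b _ => b + f) ?_ ?_ ?_ ?_
      · intro x hx
        exact (Finset.mem_filter.1 hx).2
      · intro b hb
        have hb' := Finset.mem_Icc.1 (Finset.mem_filter.1 hb).1
        refine Finset.mem_filter.2 ⟨Finset.mem_Icc.2 ⟨by omega, by omega⟩, ?_⟩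
        rwa [add_sub_cancel_right]
      · intro x _; simp
      · intro b _; simp
    rw [Finset.sum_congr rfl h1, Finset.sum_const, nsmul_eq_mul]
  obtain ⟨x, -, hx⟩ : ∃ x ∈ I, δ / 2 * F.card ≤ ((F.filter fun f => x - f ∈ B).card : ℝ) := by
    apply Finset.exists_le_of_sum_le
    · exact ⟨k + 1, Finset.mem_Icc.2 ⟨by omega, by omega⟩⟩
    · rw [hsum, Finset.sum_const, nsmul_eq_mul]
      calc (I.card : ℝ) * (δ / 2 * F.card) ≤ 2 * n * (δ / 2 * F.card) := by gcongr
        _ = F.card * (δ * n) := by ring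
        _ ≤ F.card * B.card := by gcongr
  refine ⟨F.filter fun f => x - f ∈ B, Finset.filter_subset _ _, hx, fun a ha b hb => ?_⟩
  refine ⟨x - b, (Finset.mem_filter.1 (Finset.mem_filter.1 hb).2).2,
    x - a, (Finset.mem_filter.1 (Finset.mem_filter.1 ha).2).2, ?_⟩
  dsimp only
  ring

theorem hasLargeDifferenceSubsets_of_mem_generate {x : ℤ} {U : Set ℤ}
    (hU : U ∈ Filter.generate
      {V : Set ℤ | ∃ A : Set ℤ, 0 < upperBanachDensity A ∧ V = x +ᵥ (A - A)}) :
    HasLargeDifferenceSubsets {e | x + e ∈ U} := by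
  induction hU with
  | basic h =>
    obtain ⟨A, hA, rfl⟩ := h
    obtain ⟨η, hη, h⟩ := hasLargeDifferenceSubsets_sub_self hA
    refine ⟨η, hη, fun F => ?_⟩
    obtain ⟨G, hGF, hG, hGA⟩ := h F
    exact ⟨G, hGF, hG, fun a ha b hb => ⟨a - b, hGA a ha b hb, rfl⟩⟩
  | univ => exact ⟨1, one_pos, fun F => ⟨F, subset_rfl, by simp, fun _ _ _ _ => trivial⟩⟩
  | superset _ hst ih =>
    obtain ⟨η, hη, h⟩ := ih
    refine ⟨η, hη, fun F => ?_⟩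
    obtain ⟨G, hGF, hG, hGA⟩ := h F
    exact ⟨G, hGF, hG, fun a ha b hb => hst (hGA a ha b hb)⟩
  | inter _ _ ih ih' => exact ih.inter ih'

theorem isClosed_differenceSetTopology {S : Set ℤ}
    (hS : ∀ m : ℤ, ¬ IsMeasurableRecurrence (((fun s : ℤ => s - m) '' S) \ {0})) :
    @IsClosed ℤ differenceSetTopology S := by
  rw [← @isOpen_compl_iff ℤ S differenceSetTopology]
  intro x hx
  obtain ⟨A, hA, hdisj⟩ := exists_disjoint_sub_of_not_isMeasurableRecurrence (hS x)
  refine Filter.GenerateSets.superset (Filter.GenerateSets.basic ⟨A, hA, rfl⟩) ?_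
  rintro _ ⟨e, he, rfl⟩ hxe
  refine hdisj e ⟨⟨x + e, hxe, by simp⟩, ?_⟩ he
  rintro rfl
  exact hx (by simpa using hxe)

/-- At an interior point `x` of the closed set `S`, a finite intersection of difference sets,
translated by `x`, would lie in `S`. Intersecting it further with the `A - A` that misses `(S - x) \
{0}` still leaves a nonzero difference, a contradiction. -/
theorem isNowhereDense_differenceSetTopology {S : Set ℤ}
    (hS : ∀ m : ℤ, ¬ IsMeasurableRecurrence (((fun s : ℤ => s - m) '' S) \ {0})) :
    @IsNowhereDense ℤ differenceSetTopology S := by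
  rw [@IsNowhereDense.eq_1 ℤ differenceSetTopology,
    @IsClosed.closure_eq ℤ differenceSetTopology _ (isClosed_differenceSetTopology hS),
    Set.eq_empty_iff_forall_notMem]
  intro x hx
  have hopen : @IsOpen ℤ differenceSetTopology (@interior ℤ differenceSetTopology S) :=
    @isOpen_interior ℤ differenceSetTopology S
  obtain ⟨A, hA, hdisj⟩ := exists_disjoint_sub_of_not_isMeasurableRecurrence (hS x)
  obtain ⟨e, ⟨heA, heS⟩, he0⟩ := ((hasLargeDifferenceSubsets_sub_self hA).inter
    (hasLargeDifferenceSubsets_of_mem_generate (hopen x hx))).exists_ne_zero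
  have hmem : x + e ∈ S := @interior_subset ℤ differenceSetTopology S _ heS
  exact hdisj e ⟨⟨x + e, hmem, by simp⟩, he0⟩ heA

theorem corollary1p3 (S : Set ℤ) (hS : IsBohrDense S) :
    ∃ S' : Set ℤ, S' ⊆ S ∧ IsBohrDense S' ∧
      (∀ m : ℤ, ¬ IsMeasurableRecurrence (((fun s : ℤ => s - m) '' S') \ {0})) ∧
      @IsClosed ℤ differenceSetTopology S' ∧
      @IsNowhereDense ℤ differenceSetTopology S' := by
  obtain ⟨S', hS'S, hdense, havoid⟩ := hS.exists_subset_hasAvoidingSet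
  have hrec : ∀ m : ℤ, ¬ IsMeasurableRecurrence (((fun s : ℤ => s - m) '' S') \ {0}) := by
    intro m
    obtain ⟨c, hc, h⟩ := havoid m
    exact not_isMeasurableRecurrence_of_hasAvoidingSet hc h
  exact ⟨S', hS'S, hdense, hrec, isClosed_differenceSetTopology hrec,
    isNowhereDense_differenceSetTopology hrec⟩
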